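/- Let $n\ge 2$, let $\Omega\subset\mathbb{R}^n$ be a bounded convex open set, let $\mu_0$ be a finite non-negative Borel measure on $\Omega$, let $\varphi\in C(\overline\Omega)$ be convex with $\varphi\ge 0$ on $\partial\Omega$, and let $q\in[0,n)$. For a convex function $w$ on $\Omega$ and $x_0\in\Omega$ put $$\partial w(x_0)=\{p\in\mathbb{R}^n:\ w(x)\ge w(x_0)+p\cdot(x-x_0)\ \text{ for all } x\in\Omega\},$$ and let $\mathscr{M}w$ be the Monge–Ampère measure of $w$, $\mathscr{M}w(E)=\big|\bigcup_{x\in E}\partial w(x)\big|$ for Borel $E\subset\Omega$, where $|\cdot|$ is Lebesgue measure. Let $w^q\mu_0$ denote the measure $E\mapsto\int_E w^q\,d\mu_0$ (with $0^0=1$), and let $$\mathcal{D}_{\mu_0,\varphi}=\{w\in C(\overline\Omega):\ w\ge 0 \text{ is convex},\ w=\varphi \text{ on }\partial\Omega,\ \mathscr{M}w\le w^q\mu_0 \text{ in }\Omega\}.$$ Then the class $\mathcal{D}_{\mu_0,\varphi}$ is non-empty, and its pointwise infimum $v=\inf_{w\in\mathcal{D}_{\mu_0,\varphi}}w$ on $\overline\Omega$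 belongs to $\mathcal{D}_{\mu_0,\varphi}$ and satisfies $$\mathscr{M}v=v^q\mu_0\quad\text{on }\{v>0\}\cap\Omega,$$ that is, $\mathscr{M}v(E)=\int_E v^q\,d\mu_0$ for all Borel $E\subset\{v>0\}\cap\Omega$. If moreover $d\mu_0=g\,dx$ on $\Omega$ for some $g\in L^\infty(\Omega)$ (so $g\ge 0$ almost everywhere), then $$\det D^2v=g\,v^q\,\chi_{\{v>0\}}\quad\text{in }\Omega$$ in the Aleksandrov sense, that is, $\mathscr{M}v(E)=\int_E g\,v^q\chi_{\{v>0\}}\,dx$ for all Borel $E\subset\Omega$. -/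

import Mathlib

open MeasureTheory Set
open scoped ENNReal

noncomputable section

namespace MongeAmpereObstacle

/-- The subdifferential at `x₀` of a function `w` on the set `U`: all slopes `p` such that
`w x ≥ w x₀ + p · (x - x₀)` for every `x ∈ U`. -/
def subdifferential {n : ℕ} (U : Set (EuclideanSpace ℝ (Fin n)))
    (w : EuclideanSpace ℝ (Fin n) → ℝ) (x₀ : EuclideanSpace ℝ (Fin n)) :
    Set (EuclideanSpace ℝ (Fin n)) :=
  {p | ∀ x ∈ U, w x₀ + inner ℝ p (x - x₀) ≤ w x}

/-- The Monge–Ampère measure of `w` on `U`, as a function of the Borel set `E ⊆ U`: the Lebesgue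
measure of the union of the subdifferentials of `w` at the points of `E`. -/
def mongeAmpere {n : ℕ} (U : Set (EuclideanSpace ℝ (Fin n)))
    (w : EuclideanSpace ℝ (Fin n) → ℝ) (E : Set (EuclideanSpace ℝ (Fin n))) : ℝ≥0∞ :=
  volume (⋃ x ∈ E, subdifferential U w x)

/-- The measure `w ^ q μ`, that is `E ↦ ∫_E w ^ q dμ`, for a nonnegative function `w`
(with `0 ^ 0 = 1`, so that it is `μ` when `q = 0`). -/
def powMeasure {n : ℕ} (w : EuclideanSpace ℝ (Fin n) → ℝ) (q : ℝ)
    (μ : Measure (EuclideanSpace ℝ (Fin n))) : Measure (EuclideanSpace ℝ (Fin n)) :=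
  μ.withDensity (fun x => ENNReal.ofReal (w x ^ q))

/-- The class of nonnegative convex functions `w ∈ C(closure Ω)` with `w = φ` on the boundary of
`Ω` whose Monge–Ampère measure on `Ω` is at most `w ^ q μ₀`. Functions are total in Lean; only the
values on `closure Ω` matter. -/
def admissible {n : ℕ} (Ω : Set (EuclideanSpace ℝ (Fin n)))
    (μ₀ : Measure (EuclideanSpace ℝ (Fin n))) (φ : EuclideanSpace ℝ (Fin n) → ℝ) (q : ℝ) :
    Set (EuclideanSpace ℝ (Fin n) → ℝ) :=
  {w | ContinuousOn w (closure Ω) ∧ ConvexOn ℝ (closure Ω) w ∧ (∀ x ∈ closure Ω, 0 ≤ w x) ∧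
    (∀ x ∈ frontier Ω, w x = φ x) ∧
    ∀ E, MeasurableSet E → E ⊆ Ω → mongeAmpere Ω w E ≤ powMeasure w q μ₀ E}

/-- `w` solves `det D²w = f` in `Ω` in the Aleksandrov sense, for a nonnegative function `f`:
the Monge–Ampère measure of `w` on `Ω` is `f dx`. -/
def SolvesDet {n : ℕ} (Ω : Set (EuclideanSpace ℝ (Fin n)))
    (w f : EuclideanSpace ℝ (Fin n) → ℝ) : Prop :=
  ∀ E, MeasurableSet E → E ⊆ Ω → mongeAmpere Ω w E = ∫⁻ x in E, ENNReal.ofReal (f x)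

end MongeAmpereObstacle

end

/-!
The proof is a Perron argument carried out on Legendre transforms. Write `K = closure Ω` and
`L_u p = sup_{x ∈ K} (⟪p, x⟫ - u x)` for a continuous function `u` on `K`, convex or not. The
function `L_u` is Lipschitz, so by Rademacher's theorem almost every slope `p` has a unique
maximiser, namely `∇ L_u p`. Hence the Monge–Ampère measure of `u` is the image of Lebesgue measure
under `∇ L_u` (`mongeAmpere_eq`): it is a Borel measure, it is carried by the points where `u` agrees
with its convex envelope, and it passes to limits, since pointwise convergence of the transforms
implies almost everywhere convergence of their gradients.

* Limits (`ControlledSeq`). Suppose continuous functions have boundary values `φ`, a common majorant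
  attaining them, bounded Monge–Ampère mass and convergent Legendre transforms. Then the conjugate of
  the limit is convex, continuous up to the boundary, and has boundary values `φ`. The only point that
  is not soft is that boundary values are not lost (`ControlledSeq.bdry_le_conjugate`), which is a
  form of Aleksandrov's maximum principle.
* Least element (`exists_least_admissible`). The convex envelope of a continuous supersolution is
  admissible (`envelope_mem_admissible`), and the minimum of two supersolutions is a supersolution.
  A decreasing sequence of admissible functions whose transforms exhaust the class converges to the
  least admissible function. The class is nonempty because `coneOver`, a function with boundary
  values `φ` and a high peak, has no supporting affine functions at interior points at all.
* Dirichlet problem (`exists_dirichlet`). For a finitely supported measure and `q = 0`, the least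
  admissible function must charge every atom fully: otherwise it could be lowered there by a steep
  cone. Finite measures are weak limits of finitely supported ones.
* The equation where `v > 0` (`mongeAmpere_eq_powMeasure_of_pos`). On a small ball `B` around a point
  `x₀` with `v x₀ > 0`, let `w` solve the Dirichlet problem with boundary values `v` and measure
  `c μ₀`, where `c` is slightly less than `v x₀ ^ q`. As `w` is close to `v`, replacing `v` by
  `min v w` in `B` gives a supersolution, and minimality of `v` forces `v ≤ w` in `B`. With equal
  boundary values this makes the mass of `v` on `B` at least that of `w`, which is `c μ₀ B`. The
  Besicovitch covering theorem turns these inequalities on balls into one on Borel sets.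
* The zero set (`mongeAmpere_eq_zero_of_eq_zero`). It is convex, so it has a Lebesgue null frontier,
  and at its interior points the only subgradient is `0`.
-/

namespace MongeAmpereObstacle

open Filter Topology InnerProductSpace

/-- Euclidean space of dimension `n`. -/
abbrev Euc (n : ℕ) := EuclideanSpace ℝ (Fin n)

variable {n : ℕ}

/-! ### Convex functions and their conjugates -/

/-- A convex function has a supporting affine function at every interior point of its domain. -/
theorem exists_subgradient {K : Set (Euc n)} {f : Euc n → ℝ} (hf : ConvexOn ℝ K f) {x₀ : Euc n}
    (hx₀ : x₀ ∈ interior K) : ∃ p : Euc n, ∀ x ∈ K, f x₀ + inner ℝ p (x - x₀) ≤ f x := by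
  have hfi : ConvexOn ℝ (interior K) f := hf.subset interior_subset hf.1.interior
  have hc : ContinuousOn f (interior K) := hf.continuousOn_interior
  have hopen : IsOpen {z : Euc n × ℝ | z.1 ∈ interior K ∧ f z.1 < z.2} := by
    have h1 : ContinuousOn (fun z : Euc n × ℝ => f z.1 - z.2) (Prod.fst ⁻¹' interior K) :=
      (hc.comp continuousOn_fst fun z hz => hz).sub continuousOn_snd
    have h2 := h1.isOpen_inter_preimage (isOpen_interior.preimage continuous_fst) isOpen_Iio
      (t := Iio 0)
    convert h2 using 1
    ext z
    simp
  obtain ⟨l, hl⟩ := geometric_hahn_banach_open_point hfi.convex_strict_epigraph hopen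
    (x := (x₀, f x₀)) (by simp)
  have hdec : ∀ (x : Euc n) (t : ℝ), l (x, t) = l (x, 0) + t * l (0, 1) := by
    intro x t
    have : ((x, t) : Euc n × ℝ) = (x, 0) + t • (0, 1) := by simp
    rw [this, map_add, map_smul, smul_eq_mul]
  have hneg : l (0, 1) < 0 := by
    have := hl (x₀, f x₀ + 1) ⟨hx₀, by simp⟩
    rw [hdec, hdec x₀ (f x₀)] at this
    linarith
  have hle : ∀ x ∈ interior K, l (x, 0) - l (x₀, 0) ≤ -l (0, 1) * (f x - f x₀) := by
    intro x hx
    refine le_of_forall_pos_le_add fun ε hε => ?_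
    have := hl (x, f x + ε / (-l (0, 1))) ⟨hx, by
      have : 0 < ε / (-l (0, 1)) := div_pos hε (by linarith)
      simpa using this⟩
    rw [hdec, hdec x₀ (f x₀)] at this
    have h3 : ε / (-l (0, 1)) * l (0, 1) = -ε := by
      rw [div_neg, neg_mul, div_mul_cancel₀ _ hneg.ne]
    nlinarith
  set c := -l (0, 1) with hcdef
  have hcpos : 0 < c := by rw [hcdef]; linarith
  let m : Euc n →L[ℝ] ℝ := c⁻¹ • l.comp (ContinuousLinearMap.inl ℝ (Euc n) ℝ)
  refine ⟨(InnerProductSpace.toDual ℝ (Euc n)).symm m, ?_⟩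
  have hm : ∀ y, inner ℝ ((InnerProductSpace.toDual ℝ (Euc n)).symm m) y = c⁻¹ * l (y, 0) := by
    intro y
    rw [InnerProductSpace.toDual_symm_apply]
    simp [m]
  have hint : ∀ x ∈ interior K,
      f x₀ + inner ℝ ((InnerProductSpace.toDual ℝ (Euc n)).symm m) (x - x₀) ≤ f x := by
    intro x hx
    rw [inner_sub_right, hm, hm, ← mul_sub]
    have := mul_le_mul_of_nonneg_left (hle x hx) (inv_pos.2 hcpos).le
    rw [← mul_assoc, inv_mul_cancel₀ hcpos.ne', one_mul] at this
    linarith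
  intro x hx
  -- a point of `K` is reached along the segment from `x₀`, whose points are interior
  have h1 := hint _ (hf.1.combo_interior_self_mem_interior hx₀ hx (a := 1 / 2) (b := 1 / 2)
    (by norm_num) (by norm_num) (by norm_num))
  have h2 := hf.2 (interior_subset hx₀) hx (by norm_num : (0 : ℝ) ≤ 1 / 2)
    (by norm_num : (0 : ℝ) ≤ 1 / 2) (by norm_num)
  have h3 : ((1 : ℝ) / 2) • x₀ + ((1 : ℝ) / 2) • x - x₀ = ((1 : ℝ) / 2) • (x - x₀) := by module
  rw [h3, inner_smul_right] at h1
  simp only [smul_eq_mul] at h2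
  linarith

/-- A subgradient of a function at a point of differentiability is its gradient. -/
theorem gradient_eq_of_subgradient {L : Euc n → ℝ} {p x : Euc n} (hd : DifferentiableAt ℝ L p)
    (h : ∀ p', L p + inner ℝ (p' - p) x ≤ L p') : gradient L p = x := by
  have h1 : HasFDerivAt L (toDual ℝ (Euc n) (gradient L p)) p := hd.hasGradientAt
  have h2 : HasFDerivAt (fun p' => L p' - innerSL ℝ x p')
      (toDual ℝ (Euc n) (gradient L p) - innerSL ℝ x) p :=
    h1.sub (innerSL ℝ x).hasFDerivAt
  have h3 : IsLocalMin (fun p' => L p' - innerSL ℝ x p') p := by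
    refine Filter.Eventually.of_forall fun p' => ?_
    have := h p'
    rw [inner_sub_left] at this
    simp only [innerSL_apply_apply]
    rw [real_inner_comm p x, real_inner_comm p' x]
    linarith
  have h4 := h3.hasFDerivAt_eq_zero h2
  refine ext_inner_right ℝ fun v => ?_
  have := congrArg (fun l : Euc n →L[ℝ] ℝ => l v) h4
  simp only [sub_apply, toDual_apply_apply, innerSL_apply_apply,
    zero_apply] at this
  linarith

/-- Pointwise convergence of functions with subgradients in a compact set forces convergence of
the subgradients at the points where the limit is differentiable. -/
theorem tendsto_gradient_of_subgradient {K : Set (Euc n)} (hK : IsCompact K)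
    {F : ℕ → Euc n → ℝ} {L : Euc n → ℝ} (hL : ∀ p, Tendsto (fun k => F k p) atTop (𝓝 (L p)))
    {p : Euc n} (hd : DifferentiableAt ℝ L p) {x : ℕ → Euc n} (hx : ∀ k, x k ∈ K)
    (h : ∀ k p', F k p + inner ℝ (p' - p) (x k) ≤ F k p') :
    Tendsto x atTop (𝓝 (gradient L p)) := by
  refine hK.tendsto_nhds_of_unique_mapClusterPt (Eventually.of_forall hx) fun y _ hy => ?_
  obtain ⟨s, hs, hsy⟩ := hy.tendsto_subseq
  refine (gradient_eq_of_subgradient hd fun p' => ?_).symm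
  refine le_of_tendsto_of_tendsto' (((hL p).comp hs.tendsto_atTop).add
    ((tendsto_const_nhds (x := p' - p)).inner hsy)) ((hL p').comp hs.tendsto_atTop) fun k => ?_
  exact h (s k) p'

/-- The Legendre transform of `u` over the set `K`. It is used for `K` nonempty and compact and `u`
continuous on `K`, when the supremum is attained. -/
noncomputable def legendre (K : Set (Euc n)) (u : Euc n → ℝ) (p : Euc n) : ℝ :=
  sSup ((fun x => inner ℝ p x - u x) '' K)

/-- The convex conjugate of a function on the whole space. Its value is meaningful at the points
where the supremum is finite. -/
noncomputable def conjugate (L : Euc n → ℝ) (x : Euc n) : ℝ :=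
  ⨆ p, (inner ℝ p x - L p)

section Legendre

variable {K : Set (Euc n)} {u : Euc n → ℝ}

theorem exists_legendre_eq (hK : IsCompact K) (hne : K.Nonempty) (hu : ContinuousOn u K)
    (p : Euc n) : ∃ x ∈ K, legendre K u p = inner ℝ p x - u x ∧
      ∀ y ∈ K, inner ℝ p y - u y ≤ inner ℝ p x - u x := by
  have hc : ContinuousOn (fun x => inner ℝ p x - u x) K :=
    (Continuous.continuousOn (by fun_prop)).sub hu
  obtain ⟨x, hx, hmax⟩ := hK.exists_isMaxOn hne hc
  refine ⟨x, hx, ?_, fun y hy => hmax hy⟩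
  exact IsGreatest.csSup_eq ⟨⟨x, hx, rfl⟩, by rintro _ ⟨y, hy, rfl⟩; exact hmax hy⟩

theorem le_legendre (hK : IsCompact K) (hu : ContinuousOn u K) (p : Euc n) {x : Euc n}
    (hx : x ∈ K) : inner ℝ p x - u x ≤ legendre K u p := by
  obtain ⟨y, -, h1, h2⟩ := exists_legendre_eq hK ⟨x, hx⟩ hu p
  rw [h1]
  exact h2 x hx

theorem legendre_le (hK : IsCompact K) (hne : K.Nonempty) (hu : ContinuousOn u K) {p : Euc n}
    {c : ℝ} (h : ∀ x ∈ K, inner ℝ p x - u x ≤ c) : legendre K u p ≤ c := by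
  obtain ⟨y, hy, h1, -⟩ := exists_legendre_eq hK hne hu p
  rw [h1]
  exact h y hy

theorem legendre_anti (hK : IsCompact K) (hne : K.Nonempty) {u' : Euc n → ℝ}
    (hu : ContinuousOn u K) (hu' : ContinuousOn u' K) (h : ∀ x ∈ K, u x ≤ u' x) (p : Euc n) :
    legendre K u' p ≤ legendre K u p :=
  legendre_le hK hne hu' fun x hx => by
    linarith [le_legendre hK hu p hx, h x hx]

/-- A maximiser of `x ↦ ⟪p, x⟫ - u x` is a subgradient of the Legendre transform at `p`. -/
theorem legendre_subgradient (hK : IsCompact K) (hu : ContinuousOn u K) {p x : Euc n} (hx : x ∈ K)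
    (h : ∀ y ∈ K, inner ℝ p y - u y ≤ inner ℝ p x - u x) (p' : Euc n) :
    legendre K u p + inner ℝ (p' - p) x ≤ legendre K u p' := by
  have h1 : legendre K u p ≤ inner ℝ p x - u x := legendre_le hK ⟨x, hx⟩ hu h
  have h2 := le_legendre hK hu p' hx
  rw [inner_sub_left]
  linarith

theorem legendre_sub_le (hK : IsCompact K) (hne : K.Nonempty) (hu : ContinuousOn u K) {R : ℝ}
    (hR : ∀ x ∈ K, ‖x‖ ≤ R) (p p' : Euc n) :
    legendre K u p - legendre K u p' ≤ R * ‖p - p'‖ := by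
  obtain ⟨x, hx, h1, h2⟩ := exists_legendre_eq hK hne hu p
  have h3 := legendre_subgradient hK hu hx h2 p'
  have h4 : inner ℝ (p - p') x ≤ R * ‖p - p'‖ := by
    calc inner ℝ (p - p') x ≤ ‖p - p'‖ * ‖x‖ := real_inner_le_norm _ _
      _ ≤ ‖p - p'‖ * R := by gcongr; exact hR x hx
      _ = R * ‖p - p'‖ := mul_comm _ _
  have h5 : inner ℝ (p' - p) x = -inner ℝ (p - p') x := by
    rw [← inner_neg_left, neg_sub]
  linarith

theorem abs_legendre_sub_le (hK : IsCompact K) (hne : K.Nonempty) (hu : ContinuousOn u K) {R : ℝ}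
    (hR : ∀ x ∈ K, ‖x‖ ≤ R) (p p' : Euc n) :
    |legendre K u p - legendre K u p'| ≤ R * ‖p - p'‖ := by
  rw [abs_le]
  have h1 := legendre_sub_le hK hne hu hR p p'
  have h2 := legendre_sub_le hK hne hu hR p' p
  rw [norm_sub_rev] at h2
  constructor <;> linarith

theorem exists_lipschitzWith_legendre (hK : IsCompact K) (hne : K.Nonempty)
    (hu : ContinuousOn u K) : ∃ C, LipschitzWith C (legendre K u) := by
  obtain ⟨R, hR⟩ := hK.isBounded.exists_norm_le
  have hR0 : 0 ≤ R := (norm_nonneg _).trans (hR _ hne.some_mem)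
  exact ⟨⟨R, hR0⟩, LipschitzWith.of_dist_le_mul fun p p' => by
    rw [Real.dist_eq, dist_eq_norm]
    exact abs_legendre_sub_le hK hne hu hR p p'⟩

theorem ae_differentiableAt_legendre (hK : IsCompact K) (hne : K.Nonempty) (hu : ContinuousOn u K) :
    ∀ᵐ p, DifferentiableAt ℝ (legendre K u) p :=
  let ⟨_, hC⟩ := exists_lipschitzWith_legendre hK hne hu
  hC.ae_differentiableAt

end Legendre

theorem measurable_gradient (L : Euc n → ℝ) : Measurable (gradient L) :=
  (toDual ℝ (Euc n)).symm.continuous.measurable.comp (measurable_fderiv ℝ L)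

/-! ### The Monge–Ampère measure as the image of Lebesgue measure -/

/-- Nonempty bounded convex open sets. -/
structure ConvexDomain (Ω : Set (Euc n)) : Prop where
  isOpen : IsOpen Ω
  convex : Convex ℝ Ω
  isBounded : Bornology.IsBounded Ω
  nonempty : Ω.Nonempty

namespace ConvexDomain

variable {Ω : Set (Euc n)}

theorem isCompact (hΩ : ConvexDomain Ω) : IsCompact (closure Ω) :=
  hΩ.isBounded.isCompact_closure

theorem subset_interior (hΩ : ConvexDomain Ω) : Ω ⊆ interior (closure Ω) :=
  interior_maximal subset_closure hΩ.isOpen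

theorem mem_frontier (hΩ : ConvexDomain Ω) {x : Euc n} : x ∈ frontier Ω ↔ x ∈ closure Ω ∧ x ∉ Ω := by
  rw [hΩ.isOpen.frontier_eq, Set.mem_sdiff]

theorem exists_diam (hΩ : ConvexDomain Ω) :
    ∃ D : ℝ, 0 < D ∧ ∀ x ∈ closure Ω, ∀ y ∈ closure Ω, ‖x - y‖ ≤ D := by
  obtain ⟨D, hD⟩ := hΩ.isCompact.isBounded.exists_norm_le
  refine ⟨D + D + 1, ?_, fun x hx y hy => ?_⟩
  · linarith [(norm_nonneg _).trans (hD _ (subset_closure hΩ.nonempty.some_mem))]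
  · linarith [norm_sub_le x y, hD x hx, hD y hy]

/-- At a boundary point of a convex domain there is an outer unit normal. -/
theorem exists_normal (hΩ : ConvexDomain Ω) {y : Euc n} (hy : y ∈ frontier Ω) :
    ∃ e : Euc n, ‖e‖ = 1 ∧ ∀ x ∈ closure Ω, inner ℝ e (x - y) ≤ 0 := by
  obtain ⟨l, hl⟩ := geometric_hahn_banach_open_point hΩ.convex hΩ.isOpen (hΩ.mem_frontier.1 hy).2
  set e := (toDual ℝ (Euc n)).symm l with he
  have hel : ∀ x, inner ℝ e x = l x := fun x => toDual_symm_apply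
  have hne : e ≠ 0 := by
    intro h0
    have := hl _ hΩ.nonempty.some_mem
    rw [← hel, ← hel, h0] at this
    simp at this
  refine ⟨‖e‖⁻¹ • e, norm_smul_inv_norm hne, fun x hx => ?_⟩
  have hcl : closure Ω ⊆ {x | l x ≤ l y} :=
    closure_minimal (fun x hx => (hl x hx).le) (isClosed_le l.continuous continuous_const)
  rw [real_inner_smul_left, inner_sub_right, hel, hel]
  exact mul_nonpos_of_nonneg_of_nonpos (by positivity) (sub_nonpos.2 (hcl hx))

end ConvexDomain

section

variable {Ω : Set (Euc n)} {u : Euc n → ℝ}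

theorem mem_subdifferential_iff (hu : ContinuousOn u (closure Ω)) {x p : Euc n} :
    p ∈ subdifferential Ω u x ↔
      ∀ y ∈ closure Ω, inner ℝ p y - u y ≤ inner ℝ p x - u x := by
  constructor
  · intro h y hy
    have hc : ContinuousOn (fun y => inner ℝ p y - u y) (closure Ω) :=
      (Continuous.continuousOn (by fun_prop)).sub hu
    refine ContinuousWithinAt.closure_le hy ((hc y hy).mono subset_closure)
      continuousWithinAt_const fun z hz => ?_
    have := h z hz
    rw [inner_sub_right] at this
    linarith
  · intro h y hy
    have := h y (subset_closure hy)
    rw [inner_sub_right]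
    linarith

/-- The image of Lebesgue measure under the gradient of the Legendre transform of `u`. On subsets
of `Ω` this is the Monge–Ampère measure of `u`, see `mongeAmpere_eq`. -/
noncomputable def gradientMeasure (Ω : Set (Euc n)) (u : Euc n → ℝ) : Measure (Euc n) :=
  volume.map (gradient (legendre (closure Ω) u))

theorem gradientMeasure_apply {E : Set (Euc n)} (hE : MeasurableSet E) :
    gradientMeasure Ω u E = volume (gradient (legendre (closure Ω) u) ⁻¹' E) :=
  Measure.map_apply (measurable_gradient _) hE

/-- For almost every slope `p` the function `x ↦ ⟪p, x⟫ - u x` has exactly one maximiser, the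
gradient of the Legendre transform. -/
theorem ae_gradient_isMax (hΩ : ConvexDomain Ω) (hu : ContinuousOn u (closure Ω)) :
    ∀ᵐ p, gradient (legendre (closure Ω) u) p ∈ closure Ω ∧
      (∀ y ∈ closure Ω, inner ℝ p y - u y ≤ inner ℝ p (gradient (legendre (closure Ω) u) p) -
        u (gradient (legendre (closure Ω) u) p)) ∧
      ∀ x ∈ closure Ω, (∀ y ∈ closure Ω, inner ℝ p y - u y ≤ inner ℝ p x - u x) →
        gradient (legendre (closure Ω) u) p = x := by
  filter_upwards [ae_differentiableAt_legendre hΩ.isCompact hΩ.nonempty.closure hu] with p hp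
  have key : ∀ x ∈ closure Ω, (∀ y ∈ closure Ω, inner ℝ p y - u y ≤ inner ℝ p x - u x) →
      gradient (legendre (closure Ω) u) p = x := fun x hx h =>
    gradient_eq_of_subgradient hp (legendre_subgradient hΩ.isCompact hu hx h)
  obtain ⟨x, hx, -, h⟩ := exists_legendre_eq hΩ.isCompact hΩ.nonempty.closure hu p
  have h1 := key x hx h
  rw [h1]
  exact ⟨hx, h, fun y hy hy' => h1.symm.trans (key y hy hy')⟩

theorem mongeAmpere_eq_volume (hΩ : ConvexDomain Ω) (hu : ContinuousOn u (closure Ω))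
    {E : Set (Euc n)} (hE : E ⊆ Ω) :
    mongeAmpere Ω u E = volume (gradient (legendre (closure Ω) u) ⁻¹' E) := by
  refine measure_congr ?_
  filter_upwards [ae_gradient_isMax hΩ hu] with p ⟨h1, h2, h3⟩
  refine propext ⟨fun h => ?_, fun h => ?_⟩
  · obtain ⟨x, hx, hp⟩ := mem_iUnion₂.1 h
    change gradient (legendre (closure Ω) u) p ∈ E
    rwa [h3 x (subset_closure (hE hx)) ((mem_subdifferential_iff hu).1 hp)]
  · exact mem_iUnion₂.2 ⟨_, h, (mem_subdifferential_iff hu).2 h2⟩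

theorem mongeAmpere_eq (hΩ : ConvexDomain Ω) (hu : ContinuousOn u (closure Ω))
    {E : Set (Euc n)} (hEm : MeasurableSet E) (hE : E ⊆ Ω) :
    mongeAmpere Ω u E = gradientMeasure Ω u E := by
  rw [gradientMeasure_apply hEm, mongeAmpere_eq_volume hΩ hu hE]

/-! ### The boundary estimate -/

/-- If the affine function with slope `p₀` supports `φ` at `x₀`, then every slope `p₀ + p` whose
affine function, tilted by at most `d`, cuts below the boundary values touches `u` at an
interior point. -/
theorem mem_subdifferential_of_legendre_gt (hΩ : ConvexDomain Ω) {φ : Euc n → ℝ}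
    (hu : ContinuousOn u (closure Ω)) (hb : ∀ x ∈ frontier Ω, u x = φ x) {x₀ p₀ p : Euc n} {d : ℝ}
    (hp₀ : ∀ x ∈ closure Ω, φ x₀ + inner ℝ p₀ (x - x₀) ≤ φ x)
    (hp : ∀ x ∈ closure Ω, inner ℝ p (x - x₀) ≤ d)
    (hL : inner ℝ (p₀ + p) x₀ - φ x₀ + d < legendre (closure Ω) u (p₀ + p)) :
    p₀ + p ∈ ⋃ x ∈ Ω, subdifferential Ω u x := by
  obtain ⟨x, hx, h1, h2⟩ := exists_legendre_eq hΩ.isCompact hΩ.nonempty.closure hu (p₀ + p)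
  refine mem_iUnion₂.2 ⟨x, ?_, (mem_subdifferential_iff hu).2 h2⟩
  by_contra hxΩ
  have h3 := hb x (hΩ.mem_frontier.2 ⟨hx, hxΩ⟩)
  have h4 := hp₀ x hx
  have h5 := hp x hx
  rw [h1, h3] at hL
  simp only [inner_sub_right, inner_add_left] at *
  linarith

/-- The volume of a chain of `N` disjoint balls of radius `ρ` in direction `e`. -/
theorem volume_chain_of_balls (c e : Euc n) (he : ‖e‖ = 1) (ρ : ℝ) (hρ : 0 < ρ) (N : ℕ) :
    volume (⋃ j ∈ Finset.range N, Metric.ball (c + (2 * ρ * j) • e) ρ) =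
      N * volume (Metric.ball (0 : Euc n) ρ) := by
  rw [measure_biUnion_finset]
  · simp [Measure.addHaar_ball_center]
  · intro i _ j _ hij
    refine Metric.ball_disjoint_ball ?_
    rw [dist_add_left, dist_eq_norm, ← sub_smul, norm_smul, he, mul_one, ← mul_sub, Real.norm_eq_abs,
      abs_mul, abs_of_pos (by positivity : 0 < 2 * ρ)]
    have : (1 : ℝ) ≤ |(i : ℝ) - j| := by
      have h1 : (1 : ℤ) ≤ |(i : ℤ) - j| := Int.one_le_abs (sub_ne_zero.2 (by exact_mod_cast hij))
      exact_mod_cast h1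
    nlinarith
  · intro j _
    exact Metric.isOpen_ball.measurableSet

theorem measure_le_of_forall_eventually_mem {α : Type*} [MeasurableSpace α] {μ : Measure α}
    {A : ℕ → Set α} {C : ℝ≥0∞} (hA : ∀ k, μ (A k) ≤ C) {S : Set α}
    (hS : ∀ p ∈ S, ∀ᶠ k in atTop, p ∈ A k) : μ S ≤ C := by
  have h1 : S ⊆ ⋃ m, ⋂ k ≥ m, A k := fun p hp => by
    obtain ⟨m, hm⟩ := eventually_atTop.1 (hS p hp)
    exact mem_iUnion.2 ⟨m, mem_iInter₂.2 hm⟩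
  refine (measure_mono h1).trans ?_
  rw [Monotone.measure_iUnion]
  · refine iSup_le fun m => (measure_mono (iInter₂_subset m le_rfl)).trans (hA m)
  · intro m m' hm
    exact biInter_subset_biInter_left fun k hk => le_trans hm hk

/-- A function lying more than `d` below its convex boundary datum at an interior point has
Monge–Ampère mass at least that of a ball of radius `d` over the diameter: the slopes `p₀ + p`
with `p` in that ball and `p₀` a slope of the datum at the point all touch. -/
theorem volume_ball_le_of_depth (hΩ : ConvexDomain Ω) {φ : Euc n → ℝ}
    (hφc : ConvexOn ℝ (closure Ω) φ)
    (hu : ContinuousOn u (closure Ω)) (hb : ∀ x ∈ frontier Ω, u x = φ x) {x₀ : Euc n}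
    (hx₀ : x₀ ∈ Ω) {D : ℝ} (hD0 : 0 < D) (hD : ∀ x ∈ closure Ω, ∀ y ∈ closure Ω, ‖x - y‖ ≤ D)
    {d : ℝ} (hd : u x₀ + d < φ x₀) :
    volume (Metric.ball (0 : Euc n) (d / D)) ≤ mongeAmpere Ω u Ω := by
  obtain ⟨p₀, hp₀⟩ := exists_subgradient hφc (hΩ.subset_interior hx₀)
  rw [← Measure.addHaar_ball_center _ p₀]
  refine measure_mono fun P hP => ?_
  have hP' : ‖P - p₀‖ < d / D := by rwa [Metric.mem_ball, dist_eq_norm] at hP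
  have := mem_subdifferential_of_legendre_gt hΩ (p := P - p₀) (d := d) hu hb hp₀ (fun x hx => ?_) ?_
  · simpa using this
  · calc inner ℝ (P - p₀) (x - x₀) ≤ ‖P - p₀‖ * ‖x - x₀‖ := real_inner_le_norm _ _
      _ ≤ d / D * D := mul_le_mul hP'.le (hD _ hx _ (subset_closure hx₀)) (norm_nonneg _)
          ((norm_nonneg _).trans hP'.le)
      _ = d := by field_simp
  · have := le_legendre hΩ.isCompact hu (p₀ + (P - p₀)) (subset_closure hx₀)
    linarith

end

/-! ### Limits of functions with fixed boundary values and bounded Monge–Ampère mass -/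

section

variable {Ω : Set (Euc n)} {φ : Euc n → ℝ}

/-- A sequence of continuous functions on `closure Ω` with boundary values `φ`, a common continuous
majorant with the same boundary values, uniformly bounded Monge–Ampère mass, and Legendre transforms
converging pointwise to `L`. Convexity of the functions is not required. -/
structure ControlledSeq (Ω : Set (Euc n)) (φ : Euc n → ℝ) (u : ℕ → Euc n → ℝ) (L : Euc n → ℝ) :
    Prop where
  cont : ∀ k, ContinuousOn (u k) (closure Ω)
  bdry : ∀ k, ∀ x ∈ frontier Ω, u k x = φ x
  majorant : ∃ H : Euc n → ℝ, ContinuousOn H (closure Ω) ∧ (∀ x ∈ frontier Ω, H x = φ x) ∧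
    ∀ k, ∀ x ∈ closure Ω, u k x ≤ H x
  mass : ∃ C : ℝ≥0∞, C < ∞ ∧ ∀ k, mongeAmpere Ω (u k) Ω ≤ C
  tendsto : ∀ p, Tendsto (fun k => legendre (closure Ω) (u k) p) atTop (𝓝 (L p))

namespace ControlledSeq

variable {u : ℕ → Euc n → ℝ} {L : Euc n → ℝ}

theorem bddAbove (h : ControlledSeq Ω φ u L) (hΩ : ConvexDomain Ω) {x : Euc n}
    (hx : x ∈ closure Ω) : BddAbove (range fun p => inner ℝ p x - L p) := by
  obtain ⟨H, -, -, hH⟩ := h.majorant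
  refine ⟨H x, ?_⟩
  rintro _ ⟨p, rfl⟩
  have : inner ℝ p x - H x ≤ L p := ge_of_tendsto' (h.tendsto p) fun k =>
    le_trans (by linarith [hH k x hx]) (le_legendre hΩ.isCompact (h.cont k) p hx)
  simp only
  linarith

theorem sub_le_conjugate (h : ControlledSeq Ω φ u L) (hΩ : ConvexDomain Ω) {x : Euc n}
    (hx : x ∈ closure Ω) (p : Euc n) : inner ℝ p x - L p ≤ conjugate L x :=
  le_ciSup (h.bddAbove hΩ hx) p

theorem conjugate_le (h : ControlledSeq Ω φ u L) (hΩ : ConvexDomain Ω) {x : Euc n}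
    (hx : x ∈ closure Ω) {c : ℝ} (hc : ∀ᶠ k in atTop, u k x ≤ c) : conjugate L x ≤ c := by
  refine ciSup_le fun p => ?_
  have : inner ℝ p x - c ≤ L p := ge_of_tendsto (h.tendsto p) <| hc.mono fun k hk =>
    le_trans (by linarith) (le_legendre hΩ.isCompact (h.cont k) p hx)
  linarith

theorem le_conjugate (h : ControlledSeq Ω φ u L) (hΩ : ConvexDomain Ω) {x : Euc n}
    (hx : x ∈ closure Ω) {m : ℝ} (hm : ∀ k, ∀ y ∈ closure Ω, m ≤ u k y) : m ≤ conjugate L x := by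
  have h1 : L 0 ≤ -m := le_of_tendsto' (h.tendsto 0) fun k =>
    legendre_le hΩ.isCompact hΩ.nonempty.closure (h.cont k) fun y hy => by
      rw [inner_zero_left]; linarith [hm k y hy]
  have h2 := h.sub_le_conjugate hΩ hx 0
  rw [inner_zero_left] at h2
  linarith

theorem convexOn_conjugate (h : ControlledSeq Ω φ u L) (hΩ : ConvexDomain Ω) :
    ConvexOn ℝ (closure Ω) (conjugate L) := by
  refine ⟨hΩ.convex.closure, fun x hx y hy a b ha hb hab => ciSup_le fun p => ?_⟩
  have h1 := mul_le_mul_of_nonneg_left (h.sub_le_conjugate hΩ hx p) ha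
  have h2 := mul_le_mul_of_nonneg_left (h.sub_le_conjugate hΩ hy p) hb
  rw [inner_add_right, inner_smul_right, inner_smul_right, smul_eq_mul, smul_eq_mul]
  have h3 : L p = a * L p + b * L p := by rw [← add_mul, hab, one_mul]
  linarith

theorem conjugate_le_bdry (h : ControlledSeq Ω φ u L) (hΩ : ConvexDomain Ω) {y : Euc n}
    (hy : y ∈ frontier Ω) : conjugate L y ≤ φ y :=
  h.conjugate_le hΩ (frontier_subset_closure hy) (Eventually.of_forall fun k => (h.bdry k y hy).le)

/-- The limit does not drop below the boundary values: otherwise it would lie a fixed depth `2 d`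
below `φ` at points arbitrarily close to a boundary point `y`. The slopes of the affine functions
that then touch the approximating functions contain arbitrarily many disjoint balls of a fixed
radius, placed along the outer normal at `y`, against the bound on the mass. -/
theorem bdry_le_conjugate (h : ControlledSeq Ω φ u L) (hΩ : ConvexDomain Ω)
    (hφ : ContinuousOn φ (closure Ω)) (hφc : ConvexOn ℝ (closure Ω) φ) {y : Euc n}
    (hy : y ∈ frontier Ω) : φ y ≤ conjugate L y := by
  by_contra! hlt
  have hyK := frontier_subset_closure hy
  obtain ⟨z, hz⟩ := hΩ.nonempty
  obtain ⟨e, he, hey⟩ := hΩ.exists_normal hy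
  obtain ⟨D, hD0, hD⟩ := hΩ.exists_diam
  obtain ⟨C, hC, hmass⟩ := h.mass
  -- of the slack `4 d` at `y`, moving along the segment towards `z` uses up at most `2 d`
  set d := (φ y - conjugate L y) / 4 with hd
  have hd0 : 0 < d := by rw [hd]; linarith
  -- slopes in a ball of radius `ρ` tilt by at most `d / 2` over `Ω`; the other half of `d` is left
  -- for the shift by up to `2 ρ N` along the normal, which costs little close to `y`
  set ρ := d / (2 * D) with hρ
  have hρ0 : 0 < ρ := by positivity
  obtain ⟨N, hN⟩ := ENNReal.exists_nat_mul_gt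
    (Metric.measure_ball_pos volume (0 : Euc n) hρ0).ne' hC.ne
  let x : ℝ → Euc n := fun t => y + t • (z - y)
  have hxΩ : ∀ t ∈ Ioc (0 : ℝ) 1, x t ∈ Ω := fun t ht => by
    have := hΩ.convex.add_smul_sub_mem_interior' hyK (hΩ.isOpen.interior_eq.symm ▸ hz) ht
    rwa [hΩ.isOpen.interior_eq] at this
  have hxc : Continuous x := by fun_prop
  have hx0 : x 0 = y := by simp [x]
  have hxt : Tendsto x (𝓝[>] 0) (𝓝[closure Ω] y) := by
    refine tendsto_nhdsWithin_iff.2 ⟨?_, ?_⟩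
    · have := (hxc.tendsto 0).mono_left (nhdsWithin_le_nhds (s := Ioi 0))
      rwa [hx0] at this
    · filter_upwards [Ioc_mem_nhdsGT (zero_lt_one' ℝ)] with t ht using subset_closure (hxΩ t ht)
  have e1 : ∀ᶠ t in 𝓝[>] (0 : ℝ), φ y - d < φ (x t) :=
    ((hφ y hyK).tendsto.comp hxt).eventually (lt_mem_nhds (by linarith))
  have e2 : ∀ᶠ t in 𝓝[>] (0 : ℝ),
      (1 - t) * conjugate L y + t * conjugate L z < conjugate L y + d := by
    have : Tendsto (fun t : ℝ => (1 - t) * conjugate L y + t * conjugate L z) (𝓝[>] 0)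
        (𝓝 ((1 - 0) * conjugate L y + 0 * conjugate L z)) :=
      (Continuous.tendsto (by fun_prop) 0).mono_left nhdsWithin_le_nhds
    exact this.eventually (gt_mem_nhds (by linarith))
  have e3 : ∀ᶠ t in 𝓝[>] (0 : ℝ), 2 * ρ * N * (t * ‖z - y‖) < d / 2 := by
    have : Tendsto (fun t : ℝ => 2 * ρ * N * (t * ‖z - y‖)) (𝓝[>] 0)
        (𝓝 (2 * ρ * N * (0 * ‖z - y‖))) :=
      (Continuous.tendsto (by fun_prop) 0).mono_left nhdsWithin_le_nhds
    exact this.eventually (gt_mem_nhds (by simpa using hd0))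
  obtain ⟨t, ⟨⟨h1, h2⟩, h3⟩, ht⟩ :=
    (((e1.and e2).and e3).and (Ioc_mem_nhdsGT (zero_lt_one' ℝ))).exists
  have hxt := hxΩ t ht
  obtain ⟨p₀, hp₀⟩ := exists_subgradient hφc (hΩ.subset_interior hxt)
  have hdepth : conjugate L (x t) + 2 * d < φ (x t) := by
    have h4 := (h.convexOn_conjugate hΩ).2 hyK (subset_closure hz) (sub_nonneg.2 ht.2) ht.1.le
      (by ring)
    have h5 : (1 - t) • y + t • z = x t := by simp only [x]; module
    rw [h5, smul_eq_mul, smul_eq_mul] at h4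
    linarith
  refine absurd (measure_le_of_forall_eventually_mem hmass
    (S := ⋃ j ∈ Finset.range N, Metric.ball (p₀ + (2 * ρ * j) • e) ρ) fun P hP => ?_) ?_
  · obtain ⟨j, hj, hP⟩ := mem_iUnion₂.1 hP
    have hjN : (j : ℝ) ≤ N := by exact_mod_cast (Finset.mem_range.1 hj).le
    set b := P - (p₀ + (2 * ρ * j) • e) with hb
    have hbρ : ‖b‖ < ρ := by rwa [Metric.mem_ball, dist_eq_norm] at hP
    have hPe : p₀ + (P - p₀) = P := by abel
    have hL : inner ℝ P (x t) - φ (x t) + d < L P := by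
      linarith [h.sub_le_conjugate hΩ (subset_closure hxt) P]
    filter_upwards [(h.tendsto P).eventually (lt_mem_nhds hL)] with k hk
    have := mem_subdifferential_of_legendre_gt hΩ (p := P - p₀) (d := d) (h.cont k) (h.bdry k) hp₀
      (fun w hw => ?_) (by rwa [hPe])
    · rwa [hPe] at this
    · have q1 : P - p₀ = (2 * ρ * j) • e + b := by rw [hb]; abel
      have q2 : inner ℝ b (w - x t) ≤ d / 2 := calc
        inner ℝ b (w - x t) ≤ ‖b‖ * ‖w - x t‖ := real_inner_le_norm _ _
        _ ≤ ρ * D := mul_le_mul hbρ.le (hD _ hw _ (subset_closure hxt)) (norm_nonneg _) hρ0.le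
        _ = d / 2 := by rw [hρ]; field_simp
      have q3 : inner ℝ e (w - x t) ≤ t * ‖z - y‖ := by
        have r1 : w - x t = (w - y) + (-t) • (z - y) := by simp only [x]; module
        rw [r1, inner_add_right, inner_smul_right]
        have r2 := real_inner_le_norm e (-(z - y))
        rw [norm_neg, he, one_mul, inner_neg_right] at r2
        have r3 := mul_le_mul_of_nonneg_left r2 ht.1.le
        linarith [hey w hw]
      have q4 : 2 * ρ * j * inner ℝ e (w - x t) ≤ 2 * ρ * N * (t * ‖z - y‖) := by
        have s1 : 0 ≤ t * ‖z - y‖ := mul_nonneg ht.1.le (norm_nonneg _)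
        calc 2 * ρ * j * inner ℝ e (w - x t) ≤ 2 * ρ * j * (t * ‖z - y‖) := by gcongr
          _ ≤ 2 * ρ * N * (t * ‖z - y‖) := by gcongr
      rw [q1, inner_add_left, real_inner_smul_left]
      linarith
  · rw [volume_chain_of_balls _ _ he _ hρ0]
    exact not_le.2 hN

theorem conjugate_eq_bdry (h : ControlledSeq Ω φ u L) (hΩ : ConvexDomain Ω)
    (hφ : ContinuousOn φ (closure Ω)) (hφc : ConvexOn ℝ (closure Ω) φ) {y : Euc n}
    (hy : y ∈ frontier Ω) : conjugate L y = φ y :=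
  (h.conjugate_le_bdry hΩ hy).antisymm (h.bdry_le_conjugate hΩ hφ hφc hy)

/-- The limit is continuous up to the boundary: it is lower semicontinuous as a supremum of affine
functions, and at the boundary it is squeezed by the majorant. -/
theorem continuousOn_conjugate (h : ControlledSeq Ω φ u L) (hΩ : ConvexDomain Ω)
    (hφ : ContinuousOn φ (closure Ω)) (hφc : ConvexOn ℝ (closure Ω) φ) :
    ContinuousOn (conjugate L) (closure Ω) := by
  intro x hx
  by_cases hxΩ : x ∈ Ω
  · have := (h.convexOn_conjugate hΩ).continuousOn_interior.continuousAt
      (isOpen_interior.mem_nhds (hΩ.subset_interior hxΩ))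
    exact this.continuousWithinAt
  have hxf := hΩ.mem_frontier.2 ⟨hx, hxΩ⟩
  obtain ⟨H, hHc, hHb, hH⟩ := h.majorant
  refine continuousWithinAt_iff_lower_upperSemicontinuousWithinAt.2 ⟨fun a ha => ?_, fun a ha => ?_⟩
  · obtain ⟨p, hp⟩ := exists_lt_of_lt_ciSup ha
    have hc : ContinuousWithinAt (fun x => inner ℝ p x - L p) (closure Ω) x :=
      Continuous.continuousWithinAt (by fun_prop)
    filter_upwards [hc.eventually (lt_mem_nhds hp), self_mem_nhdsWithin] with y hy hyK
    exact hy.trans_le (h.sub_le_conjugate hΩ hyK p)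
  · have hxa : H x < a := by rwa [hHb x hxf, ← h.conjugate_eq_bdry hΩ hφ hφc hxf]
    filter_upwards [(hHc x hx).eventually (gt_mem_nhds hxa), self_mem_nhdsWithin] with y hy hyK
    exact (h.conjugate_le hΩ hyK (Eventually.of_forall fun k => hH k y hyK)).trans_lt hy

theorem legendre_conjugate (h : ControlledSeq Ω φ u L) (hΩ : ConvexDomain Ω)
    (hφ : ContinuousOn φ (closure Ω)) (hφc : ConvexOn ℝ (closure Ω) φ) :
    legendre (closure Ω) (conjugate L) = L := by
  funext p
  have hc := h.continuousOn_conjugate hΩ hφ hφc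
  refine le_antisymm (legendre_le hΩ.isCompact hΩ.nonempty.closure hc fun x hx => ?_) ?_
  · linarith [h.sub_le_conjugate hΩ hx p]
  -- a limit of maximisers for the slope `p` is a subgradient of `L` at `p`
  choose x hx h1 h2 using fun k =>
    exists_legendre_eq hΩ.isCompact hΩ.nonempty.closure (h.cont k) p
  obtain ⟨y, hy, s, hs, hsy⟩ := hΩ.isCompact.tendsto_subseq hx
  have hsub : ∀ p', L p + inner ℝ (p' - p) y ≤ L p' := fun p' =>
    le_of_tendsto_of_tendsto' (((h.tendsto p).comp hs.tendsto_atTop).add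
      ((tendsto_const_nhds (x := p' - p)).inner hsy)) ((h.tendsto p').comp hs.tendsto_atTop)
      fun k => legendre_subgradient hΩ.isCompact (h.cont (s k)) (hx (s k)) (h2 (s k)) p'
  have hle : conjugate L y ≤ inner ℝ p y - L p := ciSup_le fun p' => by
    have := hsub p'
    rw [inner_sub_left] at this
    linarith
  linarith [le_legendre hΩ.isCompact hc p hy]

theorem ae_tendsto_gradient (h : ControlledSeq Ω φ u L) (hΩ : ConvexDomain Ω)
    (hφ : ContinuousOn φ (closure Ω)) (hφc : ConvexOn ℝ (closure Ω) φ) :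
    ∀ᵐ p, Tendsto (fun k => gradient (legendre (closure Ω) (u k)) p) atTop
      (𝓝 (gradient (legendre (closure Ω) (conjugate L)) p)) := by
  have h1 : ∀ᵐ p, ∀ k, _ := ae_all_iff.2 fun k => ae_gradient_isMax hΩ (h.cont k)
  filter_upwards [h1, ae_differentiableAt_legendre hΩ.isCompact hΩ.nonempty.closure
    (h.continuousOn_conjugate hΩ hφ hφc)] with p hp hd
  rw [h.legendre_conjugate hΩ hφ hφc] at hd ⊢
  exact tendsto_gradient_of_subgradient hΩ.isCompact h.tendsto hd (fun k => (hp k).1) fun k p' =>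
    legendre_subgradient hΩ.isCompact (h.cont k) (hp k).1 (hp k).2.1 p'

/-- Monge–Ampère measures are lower semicontinuous on open sets. -/
theorem mongeAmpere_le_liminf (h : ControlledSeq Ω φ u L) (hΩ : ConvexDomain Ω)
    (hφ : ContinuousOn φ (closure Ω)) (hφc : ConvexOn ℝ (closure Ω) φ) {V : Set (Euc n)}
    (hV : IsOpen V) (hVΩ : V ⊆ Ω) :
    mongeAmpere Ω (conjugate L) V ≤ liminf (fun k => mongeAmpere Ω (u k) V) atTop := by
  have hm : ∀ w : Euc n → ℝ, MeasurableSet (gradient (legendre (closure Ω) w) ⁻¹' V) := fun w =>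
    measurable_gradient _ hV.measurableSet
  rw [mongeAmpere_eq_volume hΩ (h.continuousOn_conjugate hΩ hφ hφc) hVΩ]
  simp_rw [fun k => mongeAmpere_eq_volume hΩ (h.cont k) hVΩ, ← lintegral_indicator_one (hm _)]
  refine le_trans (lintegral_mono_ae ?_)
    (lintegral_liminf_le fun k => measurable_one.indicator (hm (u k)))
  filter_upwards [h.ae_tendsto_gradient hΩ hφ hφc] with p hp
  by_cases hpV : gradient (legendre (closure Ω) (conjugate L)) p ∈ V
  · rw [indicator_of_mem (by exact hpV)]
    refine le_liminf_of_le (by isBoundedDefault) ?_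
    filter_upwards [hp.eventually (hV.mem_nhds hpV)] with k hk
    rw [indicator_of_mem (by exact hk)]
  · rw [indicator_of_notMem (by exact hpV)]
    exact zero_le

end ControlledSeq

end

/-! ### A majorant with prescribed boundary values -/

section

variable {Ω : Set (Euc n)} {φ : Euc n → ℝ}

/-- The function with boundary values `φ` and value `c` at `z ∈ Ω` that is affine on every segment
from `z` to a boundary point. -/
noncomputable def coneOver (Ω : Set (Euc n)) (φ : Euc n → ℝ) (z : Euc n) (c : ℝ) (x : Euc n) : ℝ :=
  let g := gauge ((fun y => z + y) ⁻¹' Ω) (x - z)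
  g * φ (z + g⁻¹ • (x - z)) + (1 - g) * c

section coneOver

variable {z : Euc n}

theorem ConvexDomain.nhds_preimage (hΩ : ConvexDomain Ω) (hz : z ∈ Ω) :
    (fun y => z + y) ⁻¹' Ω ∈ 𝓝 (0 : Euc n) := by
  refine (hΩ.isOpen.preimage (by fun_prop)).mem_nhds ?_
  simpa using hz

theorem ConvexDomain.convex_preimage (hΩ : ConvexDomain Ω) :
    Convex ℝ ((fun y => z + y) ⁻¹' Ω) :=
  hΩ.convex.translate_preimage_right z

theorem ConvexDomain.gauge_pos (hΩ : ConvexDomain Ω) (hz : z ∈ Ω) {y : Euc n} (hy : y ≠ 0) :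
    0 < gauge ((fun y => z + y) ⁻¹' Ω) y := by
  refine (_root_.gauge_pos (absorbent_nhds_zero (hΩ.nhds_preimage hz)) ?_).2 hy
  rw [NormedSpace.isVonNBounded_iff]
  obtain ⟨C, hC⟩ := hΩ.isBounded.exists_norm_le
  refine isBounded_iff_forall_norm_le.2 ⟨C + ‖z‖, fun w hw => ?_⟩
  have h1 := norm_sub_le (z + w) z
  rw [add_sub_cancel_left] at h1
  exact h1.trans (by gcongr; exact hC _ hw)

theorem ConvexDomain.mem_frontier_iff_gauge (hΩ : ConvexDomain Ω) (hz : z ∈ Ω) {x : Euc n} :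
    x ∈ frontier Ω ↔ gauge ((fun y => z + y) ⁻¹' Ω) (x - z) = 1 := by
  rw [gauge_eq_one_iff_mem_frontier hΩ.convex_preimage (hΩ.nhds_preimage hz)]
  have := (Homeomorph.addLeft z).preimage_frontier Ω
  rw [show (fun y => z + y) ⁻¹' Ω = (Homeomorph.addLeft z) ⁻¹' Ω from rfl, ← this]
  simp

theorem ConvexDomain.gauge_le_one (hΩ : ConvexDomain Ω) (hz : z ∈ Ω) {x : Euc n}
    (hx : x ∈ closure Ω) : gauge ((fun y => z + y) ⁻¹' Ω) (x - z) ≤ 1 := by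
  rw [gauge_le_one_iff_mem_closure hΩ.convex_preimage (hΩ.nhds_preimage hz)]
  have := (Homeomorph.addLeft z).preimage_closure Ω
  rw [show (fun y => z + y) ⁻¹' Ω = (Homeomorph.addLeft z) ⁻¹' Ω from rfl, ← this]
  simpa using hx

/-- The ray from `z` in a nonzero direction `y` meets the boundary. -/
theorem ConvexDomain.ray_mem_frontier (hΩ : ConvexDomain Ω) (hz : z ∈ Ω) {y : Euc n} (hy : y ≠ 0) :
    z + (gauge ((fun y => z + y) ⁻¹' Ω) y)⁻¹ • y ∈ frontier Ω := by
  rw [hΩ.mem_frontier_iff_gauge hz, add_sub_cancel_left,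
    gauge_smul_of_nonneg (inv_nonneg.2 (gauge_nonneg _)), smul_eq_mul,
    inv_mul_cancel₀ (hΩ.gauge_pos hz hy).ne']

theorem coneOver_eq_of_mem_frontier (hΩ : ConvexDomain Ω) (hz : z ∈ Ω) (c : ℝ) {x : Euc n}
    (hx : x ∈ frontier Ω) : coneOver Ω φ z c x = φ x := by
  simp [coneOver, (hΩ.mem_frontier_iff_gauge hz).1 hx]

theorem continuous_coneOver (hΩ : ConvexDomain Ω) (hz : z ∈ Ω) (hφ : ContinuousOn φ (closure Ω))
    (c : ℝ) : Continuous (coneOver Ω φ z c) := by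
  have hg : Continuous (fun x => gauge ((fun y => z + y) ⁻¹' Ω) (x - z)) :=
    (continuous_gauge hΩ.convex_preimage (hΩ.nhds_preimage hz)).comp (by fun_prop)
  obtain ⟨C, hC⟩ := hΩ.isCompact.exists_bound_of_continuousOn hφ
  refine continuous_iff_continuousAt.2 fun x => ?_
  rcases eq_or_ne x z with rfl | hxz
  · have h0 : coneOver Ω φ x c x = c := by simp [coneOver]
    rw [ContinuousAt, h0, tendsto_iff_norm_sub_tendsto_zero]
    -- at the vertex, the boundary values are bounded and multiplied by the vanishing gauge
    have hlim : Tendsto (fun y => gauge ((fun y => x + y) ⁻¹' Ω) (y - x) * (C + |c|)) (𝓝 x)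
        (𝓝 0) := by
      have := (hg.tendsto x).mul_const (C + |c|)
      simpa using this
    refine squeeze_zero (fun _ => norm_nonneg _) (fun y => ?_) hlim
    rcases eq_or_ne y x with rfl | hyx
    · rw [h0]; simp
    · have h1 := hC _ (frontier_subset_closure (hΩ.ray_mem_frontier hz (sub_ne_zero.2 hyx)))
      set g := gauge ((fun y => x + y) ⁻¹' Ω) (y - x) with hgdef
      have h2 : coneOver Ω φ x c y - c = g * (φ (x + g⁻¹ • (y - x)) - c) := by
        simp only [coneOver]; rw [← hgdef]; ring
      rw [h2, norm_mul, Real.norm_of_nonneg (gauge_nonneg _)]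
      exact mul_le_mul_of_nonneg_left ((norm_sub_le _ _).trans (add_le_add h1 le_rfl))
        (gauge_nonneg _)
  · have hopen : IsOpen ({z}ᶜ : Set (Euc n)) := isOpen_compl_singleton
    have hne : ∀ y ∈ ({z}ᶜ : Set (Euc n)), gauge ((fun y => z + y) ⁻¹' Ω) (y - z) ≠ 0 := fun y hy =>
      (hΩ.gauge_pos hz (sub_ne_zero.2 hy)).ne'
    have hmap : ContinuousOn
        (fun x => z + (gauge ((fun y => z + y) ⁻¹' Ω) (x - z))⁻¹ • (x - z)) {z}ᶜ :=
      continuousOn_const.add ((hg.continuousOn.inv₀ hne).smul (by fun_prop))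
    have hcomp : ContinuousOn
        (fun x => φ (z + (gauge ((fun y => z + y) ⁻¹' Ω) (x - z))⁻¹ • (x - z))) {z}ᶜ :=
      hφ.comp hmap fun y hy =>
        frontier_subset_closure (hΩ.ray_mem_frontier hz (sub_ne_zero.2 hy))
    have : ContinuousOn (coneOver Ω φ z c) {z}ᶜ :=
      (hg.continuousOn.mul hcomp).add ((continuousOn_const.sub hg.continuousOn).mul
        continuousOn_const)
    exact this.continuousAt (hopen.mem_nhds hxz)

theorem coneOver_nonneg (hΩ : ConvexDomain Ω) (hz : z ∈ Ω) (hφ0 : ∀ x ∈ frontier Ω, 0 ≤ φ x)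
    {c : ℝ} (hc : 0 ≤ c) {x : Euc n} (hx : x ∈ closure Ω) : 0 ≤ coneOver Ω φ z c x := by
  have h1 := hΩ.gauge_le_one hz hx
  rcases eq_or_ne x z with rfl | hxz
  · simpa [coneOver] using hc
  · have := hφ0 _ (hΩ.ray_mem_frontier hz (sub_ne_zero.2 hxz))
    exact add_nonneg (mul_nonneg (gauge_nonneg _) this) (mul_nonneg (by linarith) hc)

/-- A point of the segment from the vertex to a boundary point, together with that boundary
point. -/
theorem ConvexDomain.exists_ray (hΩ : ConvexDomain Ω) (hz : z ∈ Ω) {x : Euc n} (hxz : x ≠ z) :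
    ∃ b : Euc n, ∃ g : ℝ, z + b ∈ frontier Ω ∧ 0 < g ∧ x = z + g • b ∧
      (x ∈ closure Ω → g ≤ 1) ∧ (x ∈ Ω → g < 1) ∧
      ∀ (φ : Euc n → ℝ) (c : ℝ), coneOver Ω φ z c x = g * φ (z + b) + (1 - g) * c := by
  have hg := hΩ.gauge_pos hz (sub_ne_zero.2 hxz)
  refine ⟨(gauge ((fun y => z + y) ⁻¹' Ω) (x - z))⁻¹ • (x - z),
    gauge ((fun y => z + y) ⁻¹' Ω) (x - z), hΩ.ray_mem_frontier hz (sub_ne_zero.2 hxz), hg, ?_,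
    hΩ.gauge_le_one hz, fun hx => ?_, fun φ c => rfl⟩
  · rw [smul_smul, mul_inv_cancel₀ hg.ne', one_smul]
    abel
  · refine lt_of_le_of_ne (hΩ.gauge_le_one hz (subset_closure hx)) fun h => ?_
    exact (hΩ.mem_frontier.1 ((hΩ.mem_frontier_iff_gauge hz).2 h)).2 hx

/-- Through an interior point there is a chord between two boundary points. -/
theorem ConvexDomain.exists_chord [Nontrivial (Euc n)] (hΩ : ConvexDomain Ω) (hz : z ∈ Ω) :
    ∃ b : Euc n, ∃ s : ℝ, 0 < s ∧ z + b ∈ frontier Ω ∧ z - s • b ∈ frontier Ω := by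
  obtain ⟨e, he⟩ := exists_ne (0 : Euc n)
  have h1 := hΩ.gauge_pos hz he
  have h2 := hΩ.gauge_pos hz (neg_ne_zero.2 he)
  have h3 := hΩ.ray_mem_frontier hz he
  have h4 := hΩ.ray_mem_frontier hz (neg_ne_zero.2 he)
  refine ⟨_, (gauge ((fun y => z + y) ⁻¹' Ω) (-e))⁻¹ * gauge ((fun y => z + y) ⁻¹' Ω) e,
    by positivity, h3, ?_⟩
  rw [smul_smul, mul_assoc, mul_inv_cancel₀ h1.ne', mul_one, sub_eq_add_neg, ← smul_neg]
  exact h4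

/-- If the value at the vertex exceeds all boundary values, no affine function touches `coneOver`
from below at an interior point: the contact would spread along a segment to the vertex, and from
there to both ends of a chord. -/
theorem subdifferential_coneOver_eq_empty [Nontrivial (Euc n)] (hΩ : ConvexDomain Ω) (hz : z ∈ Ω)
    (hφ : ContinuousOn φ (closure Ω)) {c : ℝ} (hc : ∀ x ∈ frontier Ω, φ x < c) {x : Euc n}
    (hx : x ∈ Ω) : subdifferential Ω (coneOver Ω φ z c) x = ∅ := by
  refine eq_empty_of_forall_notMem fun p hp => ?_
  rw [mem_subdifferential_iff (continuous_coneOver hΩ hz hφ c).continuousOn] at hp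
  have hvertex : inner ℝ p x - coneOver Ω φ z c x ≤ inner ℝ p z - c := by
    rcases eq_or_ne x z with rfl | hxz
    · simp [coneOver]
    · obtain ⟨b, g, hb, hg0, hxb, -, hg1, hcone⟩ := hΩ.exists_ray hz hxz
      have h1 := hp _ (frontier_subset_closure hb)
      rw [coneOver_eq_of_mem_frontier hΩ hz c hb, hcone φ c, hxb, inner_add_right, inner_add_right,
        inner_smul_right] at h1
      rw [hcone φ c, hxb, inner_add_right, inner_smul_right]
      nlinarith [hg1 hx]
  have hneg : ∀ b, z + b ∈ frontier Ω → inner ℝ p b < 0 := fun b hb => by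
    have h1 := hp _ (frontier_subset_closure hb)
    rw [coneOver_eq_of_mem_frontier hΩ hz c hb, inner_add_right] at h1
    linarith [hc _ hb]
  obtain ⟨b, s, hs, h1, h2⟩ := hΩ.exists_chord hz
  have h3 := hneg b h1
  have h4 := hneg (-(s • b)) (by rwa [← sub_eq_add_neg])
  rw [inner_neg_right, inner_smul_right] at h4
  nlinarith

/-- A convex function is at most the bound of its boundary values. -/
theorem ConvexDomain.le_of_bdry_le [Nontrivial (Euc n)] (hΩ : ConvexDomain Ω) {w : Euc n → ℝ}
    (hw : ConvexOn ℝ (closure Ω) w) {c : ℝ} (hc : ∀ x ∈ frontier Ω, w x ≤ c) {x : Euc n}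
    (hx : x ∈ closure Ω) : w x ≤ c := by
  by_cases hxΩ : x ∈ Ω
  · obtain ⟨b, s, hs, h1, h2⟩ := hΩ.exists_chord hxΩ
    have h3 := hw.2 (frontier_subset_closure h1) (frontier_subset_closure h2)
      (by positivity : 0 ≤ s / (1 + s)) (by positivity : 0 ≤ 1 / (1 + s)) (by field_simp; ring)
    have h4 : (s / (1 + s)) • (x + b) + (1 / (1 + s)) • (x - s • b) = x := by
      have : s / (1 + s) + 1 / (1 + s) = 1 := by field_simp; ring
      calc _ = (s / (1 + s) + 1 / (1 + s)) • x := by module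
        _ = x := by rw [this, one_smul]
    rw [h4, smul_eq_mul, smul_eq_mul] at h3
    calc w x ≤ s / (1 + s) * c + 1 / (1 + s) * c := h3.trans (by
          gcongr
          · exact hc _ h1
          · exact hc _ h2)
      _ = c := by field_simp; ring
  · exact hc x (hΩ.mem_frontier.2 ⟨hx, hxΩ⟩)

theorem le_coneOver [Nontrivial (Euc n)] (hΩ : ConvexDomain Ω) (hz : z ∈ Ω) {w : Euc n → ℝ}
    (hw : ConvexOn ℝ (closure Ω) w) (hb : ∀ x ∈ frontier Ω, w x = φ x) {c : ℝ}
    (hc : ∀ x ∈ frontier Ω, φ x ≤ c) {x : Euc n} (hx : x ∈ closure Ω) :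
    w x ≤ coneOver Ω φ z c x := by
  have hwz : w z ≤ c :=
    hΩ.le_of_bdry_le hw (fun x hx => (hb x hx).trans_le (hc x hx)) (subset_closure hz)
  rcases eq_or_ne x z with rfl | hxz
  · simpa [coneOver] using hwz
  · obtain ⟨b, g, hbf, hg0, hxb, hg1, -, hcone⟩ := hΩ.exists_ray hz hxz
    have h1 := hw.2 (frontier_subset_closure hbf) (subset_closure hz) hg0.le
      (sub_nonneg.2 (hg1 hx)) (by ring)
    have h2 : g • (z + b) + (1 - g) • z = x := by rw [hxb]; module
    rw [h2, smul_eq_mul, smul_eq_mul, hb _ hbf] at h1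
    rw [hcone φ c]
    nlinarith [hg1 hx]

end coneOver

end

/-! ### Supersolutions and their convex envelopes -/

section

variable {Ω : Set (Euc n)} {φ : Euc n → ℝ} {μ : Measure (Euc n)} {q : ℝ}

theorem powMeasure_apply {w : Euc n → ℝ} {E : Set (Euc n)} (hE : MeasurableSet E) :
    powMeasure w q μ E = ∫⁻ x in E, ENNReal.ofReal (w x ^ q) ∂μ :=
  withDensity_apply _ hE

theorem powMeasure_mono {w w' : Euc n → ℝ} {E : Set (Euc n)} (hE : MeasurableSet E) (hq : 0 ≤ q)
    (h0 : ∀ x ∈ E, 0 ≤ w x) (h : ∀ x ∈ E, w x ≤ w' x) :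
    powMeasure w q μ E ≤ powMeasure w' q μ E := by
  rw [powMeasure_apply hE, powMeasure_apply hE]
  exact setLIntegral_mono' hE fun x hx =>
    ENNReal.ofReal_le_ofReal (Real.rpow_le_rpow (h0 x hx) (h x hx) hq)

theorem powMeasure_le_const {w : Euc n → ℝ} {E : Set (Euc n)} (hE : MeasurableSet E) (hq : 0 ≤ q)
    (h0 : ∀ x ∈ E, 0 ≤ w x) {M : ℝ} (h : ∀ x ∈ E, w x ≤ M) :
    powMeasure w q μ E ≤ ENNReal.ofReal (M ^ q) * μ E := by
  rw [powMeasure_apply hE, ← setLIntegral_const]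
  exact setLIntegral_mono' hE fun x hx =>
    ENNReal.ofReal_le_ofReal (Real.rpow_le_rpow (h0 x hx) (h x hx) hq)

theorem measurableSet_inter_preimage (hΩ : ConvexDomain Ω) {f : Euc n → ℝ}
    (hf : ContinuousOn f (closure Ω)) {E : Set (Euc n)} (hE : MeasurableSet E) (hEΩ : E ⊆ Ω)
    {S : Set ℝ} (hS : MeasurableSet S) : MeasurableSet (E ∩ f ⁻¹' S) := by
  classical
  have hg : Measurable (Ω.piecewise f 0) :=
    (hf.mono subset_closure).measurable_piecewise continuousOn_const hΩ.isOpen.measurableSet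
  convert hE.inter (hg hS) using 1
  ext x
  simp only [mem_inter_iff, mem_preimage, and_congr_right_iff]
  intro hx
  rw [piecewise_eq_of_mem _ _ _ (hEΩ hx)]

theorem aemeasurable_of_continuousOn_closure (hΩ : ConvexDomain Ω) {f : Euc n → ℝ}
    (hf : ContinuousOn f (closure Ω)) {E : Set (Euc n)} (hEΩ : E ⊆ Ω) :
    AEMeasurable f (μ.restrict E) :=
  ((hf.mono subset_closure).aemeasurable hΩ.isOpen.measurableSet).mono_measure
    (Measure.restrict_mono_set _ hEΩ)

/-- If `u` lies below `w` and touches it on `E`, its Monge–Ampère measure on `E` is smaller. -/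
theorem mongeAmpere_le_of_touching {u w : Euc n → ℝ} {E : Set (Euc n)} (h : ∀ x ∈ Ω, u x ≤ w x)
    (hE : ∀ x ∈ E, u x = w x) : mongeAmpere Ω u E ≤ mongeAmpere Ω w E := by
  refine measure_mono (biUnion_mono subset_rfl fun x hx p hp y hy => ?_)
  rw [← hE x hx]
  exact (hp y hy).trans (h y hy)

theorem mongeAmpere_le_inter_add_diff {u : Euc n → ℝ} (E A : Set (Euc n)) :
    mongeAmpere Ω u E ≤ mongeAmpere Ω u (E ∩ A) + mongeAmpere Ω u (E \ A) := by
  refine le_trans (le_of_eq ?_) (measure_union_le _ _)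
  rw [← biUnion_union, inter_union_sdiff]
  rfl

/-- Nonnegative continuous functions, not necessarily convex, with boundary values `φ` and
Monge–Ampère measure at most `w ^ q μ`. -/
def supersolution (Ω : Set (Euc n)) (μ : Measure (Euc n)) (φ : Euc n → ℝ) (q : ℝ) :
    Set (Euc n → ℝ) :=
  {w | ContinuousOn w (closure Ω) ∧ (∀ x ∈ closure Ω, 0 ≤ w x) ∧ (∀ x ∈ frontier Ω, w x = φ x) ∧
    ∀ E, MeasurableSet E → E ⊆ Ω → mongeAmpere Ω w E ≤ powMeasure w q μ E}

theorem admissible_subset_supersolution : admissible Ω μ φ q ⊆ supersolution Ω μ φ q :=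
  fun _ h => ⟨h.1, h.2.2.1, h.2.2.2.1, h.2.2.2.2⟩

/-- The convex envelope of `u` on `closure Ω`, as the biconjugate. -/
noncomputable def envelope (Ω : Set (Euc n)) (u : Euc n → ℝ) : Euc n → ℝ :=
  conjugate (legendre (closure Ω) u)

theorem controlledSeq_const (hΩ : ConvexDomain Ω) (hμ : μ Ω < ∞) (hq : 0 ≤ q) {u : Euc n → ℝ}
    (hu : u ∈ supersolution Ω μ φ q) :
    ControlledSeq Ω φ (fun _ => u) (legendre (closure Ω) u) where
  cont _ := hu.1
  bdry _ := hu.2.2.1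
  majorant := ⟨u, hu.1, hu.2.2.1, fun _ _ _ => le_rfl⟩
  mass := by
    obtain ⟨M, hM⟩ := hΩ.isCompact.bddAbove_image hu.1
    refine ⟨_, ENNReal.mul_lt_top ENNReal.ofReal_lt_top hμ, fun _ =>
      (hu.2.2.2 Ω hΩ.isOpen.measurableSet subset_rfl).trans (powMeasure_le_const
        hΩ.isOpen.measurableSet hq (fun x hx => hu.2.1 x (subset_closure hx)) (M := M)
        fun x hx => hM ⟨x, subset_closure hx, rfl⟩)⟩
  tendsto _ := tendsto_const_nhds

theorem envelope_le (hΩ : ConvexDomain Ω) (hμ : μ Ω < ∞) (hq : 0 ≤ q) {u : Euc n → ℝ}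
    (hu : u ∈ supersolution Ω μ φ q) {x : Euc n} (hx : x ∈ closure Ω) : envelope Ω u x ≤ u x :=
  (controlledSeq_const hΩ hμ hq hu).conjugate_le hΩ hx (Eventually.of_forall fun _ => le_rfl)

/-- The convex envelope of a supersolution is admissible: its Monge–Ampère measure is that of the
function itself and is carried by the set where the two functions agree. -/
theorem envelope_mem_admissible (hΩ : ConvexDomain Ω) (hφ : ContinuousOn φ (closure Ω))
    (hφc : ConvexOn ℝ (closure Ω) φ) (hμ : μ Ω < ∞) (hq : 0 ≤ q) {u : Euc n → ℝ}
    (hu : u ∈ supersolution Ω μ φ q) : envelope Ω u ∈ admissible Ω μ φ q := by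
  have h := controlledSeq_const hΩ hμ hq hu
  have hc : ContinuousOn (envelope Ω u) (closure Ω) := h.continuousOn_conjugate hΩ hφ hφc
  have h0 : ∀ x ∈ closure Ω, 0 ≤ envelope Ω u x := fun x hx =>
    h.le_conjugate hΩ hx fun _ => hu.2.1
  refine ⟨hc, h.convexOn_conjugate hΩ, h0, fun x hx => h.conjugate_eq_bdry hΩ hφ hφc hx,
    fun E hE hEΩ => ?_⟩
  set E' := E ∩ (fun x => envelope Ω u x - u x) ⁻¹' {0} with hE'
  have hE'm : MeasurableSet E' :=
    measurableSet_inter_preimage hΩ (hc.sub hu.1) hE hEΩ (measurableSet_singleton 0)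
  have hE'Ω : E' ⊆ Ω := inter_subset_left.trans hEΩ
  have heq : ∀ x ∈ E', u x = envelope Ω u x := fun x hx => (sub_eq_zero.1 hx.2).symm
  calc mongeAmpere Ω (envelope Ω u) E
      = volume (gradient (legendre (closure Ω) u) ⁻¹' E) := by
        rw [mongeAmpere_eq_volume hΩ hc hEΩ, envelope, h.legendre_conjugate hΩ hφ hφc]
    _ ≤ volume (gradient (legendre (closure Ω) u) ⁻¹' E') := by
        refine measure_mono_ae ?_
        filter_upwards [ae_gradient_isMax hΩ hu.1] with p ⟨h1, h2, _⟩ hp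
        refine ⟨hp, sub_eq_zero.2 ?_⟩
        refine (envelope_le hΩ hμ hq hu h1).antisymm ?_
        have h3 := h.sub_le_conjugate hΩ h1 p
        have h4 := legendre_le hΩ.isCompact hΩ.nonempty.closure hu.1 h2
        change _ ≤ conjugate _ _
        linarith
    _ = mongeAmpere Ω u E' := (mongeAmpere_eq_volume hΩ hu.1 hE'Ω).symm
    _ ≤ powMeasure u q μ E' := hu.2.2.2 _ hE'm hE'Ω
    _ ≤ powMeasure (envelope Ω u) q μ E' := powMeasure_mono hE'm hq
        (fun x hx => hu.2.1 x (subset_closure (hE'Ω hx))) fun x hx => (heq x hx).le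
    _ ≤ powMeasure (envelope Ω u) q μ E := measure_mono inter_subset_left

theorem min_mem_supersolution (hΩ : ConvexDomain Ω) (hq : 0 ≤ q) {u w : Euc n → ℝ}
    (hu : u ∈ supersolution Ω μ φ q) (hw : w ∈ supersolution Ω μ φ q) :
    (fun x => min (u x) (w x)) ∈ supersolution Ω μ φ q := by
  refine ⟨hu.1.inf hw.1, fun x hx => le_min (hu.2.1 x hx) (hw.2.1 x hx),
    fun x hx => by simp only [hu.2.2.1 x hx, hw.2.2.1 x hx, min_self], fun E hE hEΩ => ?_⟩
  set A := (fun x => u x - w x) ⁻¹' Iic 0 with hA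
  have h1 : MeasurableSet (E ∩ A) :=
    measurableSet_inter_preimage hΩ (hu.1.sub hw.1) hE hEΩ measurableSet_Iic
  have h2 : MeasurableSet (E \ A) := by
    rw [← sdiff_self_inter]
    exact hE.diff h1
  have e1 : ∀ x ∈ E ∩ A, min (u x) (w x) = u x := fun x hx => min_eq_left (sub_nonpos.1 hx.2)
  have e2 : ∀ x ∈ E \ A, min (u x) (w x) = w x := fun x hx => by
    have : 0 < u x - w x := not_le.1 hx.2
    exact min_eq_right (by linarith)
  have hK1 : E ∩ A ⊆ Ω := inter_subset_left.trans hEΩ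
  have hK2 : E \ A ⊆ Ω := sdiff_subset.trans hEΩ
  calc mongeAmpere Ω (fun x => min (u x) (w x)) E
      ≤ mongeAmpere Ω (fun x => min (u x) (w x)) (E ∩ A) +
        mongeAmpere Ω (fun x => min (u x) (w x)) (E \ A) := mongeAmpere_le_inter_add_diff E A
    _ ≤ mongeAmpere Ω u (E ∩ A) + mongeAmpere Ω w (E \ A) := add_le_add
        (mongeAmpere_le_of_touching (fun x _ => min_le_left _ _) e1)
        (mongeAmpere_le_of_touching (fun x _ => min_le_right _ _) e2)
    _ ≤ powMeasure u q μ (E ∩ A) + powMeasure w q μ (E \ A) :=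
        add_le_add (hu.2.2.2 _ h1 hK1) (hw.2.2.2 _ h2 hK2)
    _ ≤ powMeasure (fun x => min (u x) (w x)) q μ (E ∩ A) +
        powMeasure (fun x => min (u x) (w x)) q μ (E \ A) := add_le_add
        (powMeasure_mono h1 hq (fun x hx => hu.2.1 x (subset_closure (hK1 hx)))
          fun x hx => (e1 x hx).ge)
        (powMeasure_mono h2 hq (fun x hx => hw.2.1 x (subset_closure (hK2 hx)))
          fun x hx => (e2 x hx).ge)
    _ = powMeasure (fun x => min (u x) (w x)) q μ E := by
        have h3 := measure_inter_add_sdiff (μ := powMeasure (fun x => min (u x) (w x)) q μ) E h1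
        rwa [sdiff_self_inter, ← inter_assoc, inter_self] at h3

theorem admissible_nonempty [Nontrivial (Euc n)] (hΩ : ConvexDomain Ω)
    (hφ : ContinuousOn φ (closure Ω)) (hφc : ConvexOn ℝ (closure Ω) φ)
    (hφ0 : ∀ x ∈ frontier Ω, 0 ≤ φ x) (hμ : μ Ω < ∞) (hq : 0 ≤ q) :
    (admissible Ω μ φ q).Nonempty := by
  obtain ⟨z, hz⟩ := hΩ.nonempty
  obtain ⟨C, hC⟩ := hΩ.isCompact.exists_bound_of_continuousOn hφ
  have hC0 : 0 ≤ C := (norm_nonneg _).trans (hC z (subset_closure hz))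
  have hlt : ∀ x ∈ frontier Ω, φ x < C + 1 := fun x hx => by
    linarith [le_abs_self (φ x), hC x (frontier_subset_closure hx), Real.norm_eq_abs (φ x)]
  refine ⟨envelope Ω (coneOver Ω φ z (C + 1)), envelope_mem_admissible hΩ hφ hφc hμ hq
    ⟨(continuous_coneOver hΩ hz hφ _).continuousOn,
      fun x hx => coneOver_nonneg hΩ hz hφ0 (by linarith) hx,
      fun x hx => coneOver_eq_of_mem_frontier hΩ hz _ hx, fun E _ hE => ?_⟩⟩
  have : (⋃ x ∈ E, subdifferential Ω (coneOver Ω φ z (C + 1)) x) = ∅ :=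
    iUnion_eq_empty.2 fun x => iUnion_eq_empty.2 fun hx =>
      subdifferential_coneOver_eq_empty hΩ hz hφ hlt (hE hx)
  rw [mongeAmpere, this, measure_empty]
  exact zero_le

end

/-! ### The least admissible function -/

section

variable {Ω : Set (Euc n)} {φ : Euc n → ℝ} {μ : Measure (Euc n)} {q : ℝ}

theorem measure_le_of_forall_isOpen_le {α : Type*} [TopologicalSpace α] [MeasurableSpace α]
    {σ τ : Measure α} [τ.OuterRegular] (h : ∀ V, IsOpen V → σ V ≤ τ V) : σ ≤ τ := by
  refine Measure.le_iff'.2 fun E => ?_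
  rw [E.measure_eq_iInf_isOpen τ]
  exact le_iInf₂ fun V hEV => le_iInf fun hV => (measure_mono hEV).trans (h V hV)

/-- A decreasing sequence of admissible functions whose Legendre transforms increase to the
supremum over the whole class. -/
theorem exists_antitone_seq_admissible [Nontrivial (Euc n)] (hΩ : ConvexDomain Ω)
    (hφ : ContinuousOn φ (closure Ω)) (hφc : ConvexOn ℝ (closure Ω) φ)
    (hφ0 : ∀ x ∈ frontier Ω, 0 ≤ φ x) (hμ : μ Ω < ∞) (hq : 0 ≤ q) :
    ∃ (W : ℕ → Euc n → ℝ) (L : Euc n → ℝ), (∀ k, W k ∈ admissible Ω μ φ q) ∧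
      (∀ k, ∀ x ∈ closure Ω, W (k + 1) x ≤ W k x) ∧
      (∀ p, Tendsto (fun k => legendre (closure Ω) (W k) p) atTop (𝓝 (L p))) ∧
      ∀ w ∈ admissible Ω μ φ q, ∀ p, legendre (closure Ω) w p ≤ L p := by
  set 𝓕 := legendre (closure Ω) '' admissible Ω μ φ q with h𝓕
  have hne : 𝓕.Nonempty := (admissible_nonempty hΩ hφ hφc hφ0 hμ hq).image _
  have hbdd : BddAbove 𝓕 := by
    refine ⟨legendre (closure Ω) fun _ => 0, ?_⟩
    rintro _ ⟨w, hw, rfl⟩ p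
    exact legendre_anti hΩ.isCompact hΩ.nonempty.closure continuousOn_const hw.1 hw.2.2.1 p
  have hL : IsLUB 𝓕 (sSup 𝓕) := isLUB_csSup hne hbdd
  have hlsc : ∀ f ∈ 𝓕, LowerSemicontinuous f := by
    rintro _ ⟨w, hw, rfl⟩
    obtain ⟨C, hC⟩ := exists_lipschitzWith_legendre hΩ.isCompact hΩ.nonempty.closure hw.1
    exact hC.continuous.lowerSemicontinuous
  obtain ⟨𝓕', hsub, hcount, hL'⟩ := exists_countable_lowerSemicontinuous_isLUB hlsc hL
  set L := sSup 𝓕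
  have hne' : 𝓕'.Nonempty := by
    by_contra! hemp
    rw [hemp, isLUB_empty_iff] at hL'
    have := hL' (fun p => L p - 1) 0
    simp only at this
    linarith
  obtain ⟨f, hf⟩ := hcount.exists_eq_range hne'
  have hmem : ∀ i, ∃ w ∈ admissible Ω μ φ q, legendre (closure Ω) w = f i := fun i =>
    hsub (hf ▸ mem_range_self i)
  choose w hw hwf using hmem
  let W : ℕ → Euc n → ℝ := fun k => Nat.rec (w 0)
    (fun k v => envelope Ω fun x => min (v x) (w (k + 1) x)) k
  have hW1 : ∀ k, W (k + 1) = envelope Ω fun x => min (W k x) (w (k + 1) x) := fun _ => rfl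
  have hmin : ∀ k, W k ∈ admissible Ω μ φ q →
      (fun x => min (W k x) (w (k + 1) x)) ∈ supersolution Ω μ φ q := fun k hk =>
    min_mem_supersolution hΩ hq (admissible_subset_supersolution hk)
      (admissible_subset_supersolution (hw _))
  have hW : ∀ k, W k ∈ admissible Ω μ φ q := fun k => by
    induction k with
    | zero => exact hw 0
    | succ k ih => exact envelope_mem_admissible hΩ hφ hφc hμ hq (hmin k ih)
  have hanti : ∀ k, ∀ x ∈ closure Ω, W (k + 1) x ≤ W k x := fun k x hx =>
    (envelope_le hΩ hμ hq (hmin k (hW k)) hx).trans (min_le_left _ _)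
  have hle : ∀ k, ∀ x ∈ closure Ω, W k x ≤ w k x := fun k x hx => by
    cases k with
    | zero => exact le_rfl
    | succ k => exact (envelope_le hΩ hμ hq (hmin k (hW k)) hx).trans (min_le_right _ _)
  have hleL : ∀ w ∈ admissible Ω μ φ q, ∀ p, legendre (closure Ω) w p ≤ L p := fun w hw p =>
    hL.1 (mem_image_of_mem _ hw) p
  refine ⟨W, L, hW, hanti, fun p => ?_, hleL⟩
  refine tendsto_atTop_isLUB (monotone_nat_of_le_succ fun k => legendre_anti hΩ.isCompact
    hΩ.nonempty.closure (hW (k + 1)).1 (hW k).1 (hanti k) p) ⟨?_, fun b hb => ?_⟩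
  · rintro _ ⟨k, rfl⟩
    exact hleL _ (hW k) p
  · refine (isLUB_pi.1 hL' p).2 ?_
    rintro _ ⟨g, hg, rfl⟩
    rw [hf] at hg
    obtain ⟨i, rfl⟩ := hg
    rw [Function.eval, ← hwf i]
    exact (legendre_anti hΩ.isCompact hΩ.nonempty.closure (hW i).1 (hw i).1 (hle i) p).trans
      (hb ⟨i, rfl⟩)

/-- The class of admissible functions has a least element. -/
theorem exists_least_admissible [Nontrivial (Euc n)] (hΩ : ConvexDomain Ω)
    (hφ : ContinuousOn φ (closure Ω)) (hφc : ConvexOn ℝ (closure Ω) φ)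
    (hφ0 : ∀ x ∈ frontier Ω, 0 ≤ φ x) (hμ : μ Ω < ∞) (hq : 0 ≤ q) :
    ∃ v ∈ admissible Ω μ φ q, ∀ w ∈ admissible Ω μ φ q, ∀ x ∈ closure Ω, v x ≤ w x := by
  obtain ⟨W, L, hW, hstep, hL, hleL⟩ := exists_antitone_seq_admissible hΩ hφ hφc hφ0 hμ hq
  have hanti : ∀ x ∈ closure Ω, Antitone fun k => W k x := fun x hx =>
    antitone_nat_of_succ_le fun k => hstep k x hx
  obtain ⟨M, hM⟩ := hΩ.isCompact.bddAbove_image (hW 0).1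
  have hWM : ∀ k, ∀ x ∈ closure Ω, W k x ≤ M := fun k x hx =>
    (hanti x hx (Nat.zero_le k)).trans (hM ⟨x, hx, rfl⟩)
  have hΩm := hΩ.isOpen.measurableSet
  have h : ControlledSeq Ω φ W L :=
    { cont := fun k => (hW k).1
      bdry := fun k => (hW k).2.2.2.1
      majorant := ⟨W 0, (hW 0).1, (hW 0).2.2.2.1, fun k x hx => hanti x hx (Nat.zero_le k)⟩
      mass := ⟨_, ENNReal.mul_lt_top ENNReal.ofReal_lt_top hμ, fun k =>
        ((hW k).2.2.2.2 Ω hΩm subset_rfl).trans (powMeasure_le_const hΩm hq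
          (fun x hx => (hW k).2.2.1 x (subset_closure hx))
          fun x hx => hWM k x (subset_closure hx))⟩
      tendsto := hL }
  set v := conjugate L with hv
  have hvc : ContinuousOn v (closure Ω) := h.continuousOn_conjugate hΩ hφ hφc
  have hv0 : ∀ x ∈ closure Ω, 0 ≤ v x := fun x hx => h.le_conjugate hΩ hx fun k => (hW k).2.2.1
  have hleast : ∀ w ∈ admissible Ω μ φ q, ∀ x ∈ closure Ω, v x ≤ w x := fun w hw x hx =>
    ciSup_le fun p => by linarith [hleL w hw p, le_legendre hΩ.isCompact hw.1 p hx]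
  have hvM : ∀ x ∈ closure Ω, v x ≤ M := fun x hx => (hleast _ (hW 0) x hx).trans (hWM 0 x hx)
  -- In the interior the sequence converges to `v`: its pointwise limit is convex, and a supporting
  -- affine function of the limit is one of the affine functions in the definition of `v`.
  have hlim : ∀ x ∈ closure Ω, Tendsto (fun k => W k x) atTop (𝓝 (⨅ k, W k x)) := fun x hx =>
    tendsto_atTop_ciInf (hanti x hx) ⟨0, by rintro _ ⟨k, rfl⟩; exact (hW k).2.2.1 x hx⟩
  have hconv : ConvexOn ℝ (closure Ω) fun x => ⨅ k, W k x := by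
    refine ⟨hΩ.convex.closure, fun x hx y hy a b ha hb hab => ?_⟩
    exact le_of_tendsto_of_tendsto' (hlim _ (hΩ.convex.closure hx hy ha hb hab))
      (((hlim x hx).const_mul a).add ((hlim y hy).const_mul b))
      fun k => (hW k).2.1.2 hx hy ha hb hab
  have hptw : ∀ x ∈ Ω, Tendsto (fun k => W k x) atTop (𝓝 (v x)) := fun x hx => by
    have hxK := subset_closure hx
    obtain ⟨p, hp⟩ := exists_subgradient hconv (hΩ.subset_interior hx)
    have h1 : L p ≤ inner ℝ p x - ⨅ k, W k x := le_of_tendsto' (hL p) fun k =>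
      legendre_le hΩ.isCompact hΩ.nonempty.closure (hW k).1 fun y hy => by
        have h2 := hp y hy
        have h3 : ⨅ k, W k y ≤ W k y := (hanti y hy).le_of_tendsto (hlim y hy) k
        rw [inner_sub_right] at h2
        linarith
    have h4 : ⨅ k, W k x ≤ v x := by linarith [h.sub_le_conjugate hΩ hxK p]
    have h5 : v x = ⨅ k, W k x := (le_ciInf fun k => hleast _ (hW k) x hxK).antisymm h4
    rw [h5]
    exact hlim x hxK
  have hopen : ∀ V, IsOpen V → V ⊆ Ω → mongeAmpere Ω v V ≤ powMeasure v q μ V := by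
    intro V hV hVΩ
    have hmeas : ∀ w : Euc n → ℝ, ContinuousOn w (closure Ω) →
        AEMeasurable (fun x => ENNReal.ofReal (w x ^ q)) (μ.restrict V) := fun w hw =>
      ((aemeasurable_of_continuousOn_closure hΩ hw hVΩ).pow_const q).ennreal_ofReal
    have hconv : Tendsto (fun k => powMeasure (W k) q μ V) atTop (𝓝 (powMeasure v q μ V)) := by
      simp_rw [powMeasure_apply hV.measurableSet]
      refine tendsto_lintegral_of_dominated_convergence' (fun _ => ENNReal.ofReal (M ^ q))
        (fun k => hmeas _ (hW k).1) (fun k => ?_) ?_ ?_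
      · filter_upwards [ae_restrict_mem hV.measurableSet] with x hx
        exact ENNReal.ofReal_le_ofReal (Real.rpow_le_rpow
          ((hW k).2.2.1 x (subset_closure (hVΩ hx))) (hWM k x (subset_closure (hVΩ hx))) hq)
      · rw [setLIntegral_const]
        exact (ENNReal.mul_lt_top ENNReal.ofReal_lt_top
          ((measure_mono hVΩ).trans_lt hμ)).ne
      · filter_upwards [ae_restrict_mem hV.measurableSet] with x hx
        exact (ENNReal.continuous_ofReal.tendsto _).comp
          (((Real.continuous_rpow_const hq).tendsto _).comp (hptw x (hVΩ hx)))
    refine (h.mongeAmpere_le_liminf hΩ hφ hφc hV hVΩ).trans ?_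
    rw [← hconv.liminf_eq]
    exact liminf_le_liminf (Eventually.of_forall fun k =>
      (hW k).2.2.2.2 V hV.measurableSet hVΩ)
  have hfin : IsFiniteMeasure ((powMeasure v q μ).restrict Ω) := ⟨by
    rw [Measure.restrict_apply_univ]
    exact (powMeasure_le_const hΩm hq (fun x hx => hv0 x (subset_closure hx))
      fun x hx => hvM x (subset_closure hx)).trans_lt
      (ENNReal.mul_lt_top ENNReal.ofReal_lt_top hμ)⟩
  have hle : (gradientMeasure Ω v).restrict Ω ≤ (powMeasure v q μ).restrict Ω := by
    refine measure_le_of_forall_isOpen_le fun V hV => ?_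
    rw [Measure.restrict_apply hV.measurableSet, Measure.restrict_apply hV.measurableSet,
      ← mongeAmpere_eq hΩ hvc (hV.inter hΩ.isOpen).measurableSet inter_subset_right]
    exact hopen _ (hV.inter hΩ.isOpen) inter_subset_right
  refine ⟨v, ⟨hvc, h.convexOn_conjugate hΩ, hv0, fun x hx => h.conjugate_eq_bdry hΩ hφ hφc hx,
    fun E hE hEΩ => ?_⟩, hleast⟩
  have := hle E
  rwa [Measure.restrict_apply hE, Measure.restrict_apply hE, inter_eq_left.2 hEΩ,
    ← mongeAmpere_eq hΩ hvc hE hEΩ] at this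

end

/-! ### The Dirichlet problem for a finitely supported measure -/

section

variable {Ω : Set (Euc n)}

theorem exists_volume_ball_gt [Nontrivial (Euc n)] {c : ℝ≥0∞} (hc : c < ∞) :
    ∃ ρ : ℝ, 0 < ρ ∧ c < volume (Metric.ball (0 : Euc n) ρ) := by
  have : NoncompactSpace (Euc n) := NormedSpace.noncompactSpace ℝ (Euc n)
  have h1 : volume (⋃ k : ℕ, Metric.ball (0 : Euc n) k) = ∞ := by
    rw [Metric.iUnion_ball_nat]
    exact measure_univ_of_isAddLeftInvariant volume
  rw [Monotone.measure_iUnion fun i j hij => Metric.ball_subset_ball (by exact_mod_cast hij)] at h1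
  obtain ⟨k, hk⟩ := lt_iSup_iff.1 (h1 ▸ hc)
  refine ⟨k, ?_, hk⟩
  by_contra! h0
  rw [Metric.ball_eq_empty.2 h0, measure_empty] at hk
  exact not_lt_zero hk

theorem norm_mul_half_le_of_inner_le {p x : Euc n} {δ c : ℝ} (hδ : 0 < δ)
    (hball : Metric.ball x δ ⊆ Ω) (h : ∀ y ∈ Ω, inner ℝ p (y - x) ≤ c) : ‖p‖ * (δ / 2) ≤ c := by
  rcases eq_or_ne p 0 with rfl | hp
  · have := h x (hball (Metric.mem_ball_self hδ))
    simpa using this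
  · have hp' : 0 < ‖p‖ := norm_pos_iff.2 hp
    have := h (x + (δ / 2 / ‖p‖) • p) (hball ?_)
    · rw [add_sub_cancel_left, inner_smul_right, real_inner_self_eq_norm_sq] at this
      calc ‖p‖ * (δ / 2) = δ / 2 / ‖p‖ * ‖p‖ ^ 2 := by field_simp
        _ ≤ c := this
    · rw [Metric.mem_ball, dist_eq_norm, add_sub_cancel_left, norm_smul, Real.norm_eq_abs,
        abs_of_pos (by positivity), div_mul_cancel₀ _ hp'.ne']
      linarith

/-- Away from its vertex, a cone of slope `Λ` has only subgradients of norm `Λ`. -/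
theorem norm_eq_of_mem_subdifferential_cone (hΩ : ConvexDomain Ω) {x₁ x p : Euc n} (hx₁ : x₁ ∈ Ω)
    (hx : x ∈ Ω) (hne : x ≠ x₁) {a Λ : ℝ} (hΛ : 0 ≤ Λ)
    (hp : p ∈ subdifferential Ω (fun y => a + Λ * ‖y - x₁‖) x) : ‖p‖ = Λ := by
  have hpos : 0 < ‖x - x₁‖ := norm_pos_iff.2 (sub_ne_zero.2 hne)
  refine le_antisymm ?_ ?_
  · rcases eq_or_ne p 0 with rfl | hp0
    · simpa using hΛ
    · have hp' : 0 < ‖p‖ := norm_pos_iff.2 hp0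
      obtain ⟨δ, hδ, hball⟩ := Metric.isOpen_iff.1 hΩ.isOpen x hx
      have h1 := hp (x + (δ / 2 / ‖p‖) • p) (hball (by
        rw [Metric.mem_ball, dist_eq_norm, add_sub_cancel_left, norm_smul, Real.norm_eq_abs,
          abs_of_pos (by positivity), div_mul_cancel₀ _ hp'.ne']
        linarith))
      have h2 : ‖x + (δ / 2 / ‖p‖) • p - x₁‖ ≤ ‖x - x₁‖ + δ / 2 := by
        have h3 := norm_add_le (x - x₁) ((δ / 2 / ‖p‖) • p)
        rw [norm_smul, Real.norm_eq_abs, abs_of_pos (by positivity : 0 < δ / 2 / ‖p‖),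
          div_mul_cancel₀ _ hp'.ne'] at h3
        rwa [show x + (δ / 2 / ‖p‖) • p - x₁ = x - x₁ + (δ / 2 / ‖p‖) • p by abel]
      rw [add_sub_cancel_left, inner_smul_right, real_inner_self_eq_norm_sq,
        show δ / 2 / ‖p‖ * ‖p‖ ^ 2 = ‖p‖ * (δ / 2) by field_simp] at h1
      have h4 := mul_le_mul_of_nonneg_left h2 hΛ
      have h5 : ‖p‖ * (δ / 2) ≤ Λ * (δ / 2) := by linarith
      exact le_of_mul_le_mul_right h5 (by positivity)
  · have h1 := hp x₁ hx₁
    have h2 := real_inner_le_norm p (x - x₁)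
    rw [← neg_sub x x₁, inner_neg_right] at h1
    simp only [sub_self, norm_zero, mul_zero, add_zero] at h1
    have h3 : Λ * ‖x - x₁‖ ≤ ‖p‖ * ‖x - x₁‖ := by linarith
    exact le_of_mul_le_mul_right h3 hpos

theorem powMeasure_zero_apply {ν : Measure (Euc n)} {w : Euc n → ℝ} {E : Set (Euc n)}
    (hE : MeasurableSet E) : powMeasure w 0 ν E = ν E := by
  rw [powMeasure_apply hE]
  simp

/-- The set of slopes of affine functions that touch `v` at `x₁` up to an error `ε` decreases to
the subdifferential as `ε` tends to zero, and so does its volume, because the slopes stay bounded. -/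
theorem exists_volume_approx_subdifferential_lt (hΩ : ConvexDomain Ω) {v : Euc n → ℝ}
    (hv : ContinuousOn v (closure Ω)) {x₁ : Euc n} (hx₁ : x₁ ∈ Ω) {c : ℝ≥0∞}
    (hc : mongeAmpere Ω v {x₁} < c) :
    ∃ ε : ℝ, 0 < ε ∧ ε ≤ 1 ∧
      volume {p | legendre (closure Ω) v p ≤ inner ℝ p x₁ - v x₁ + ε} < c := by
  obtain ⟨C, hC⟩ := exists_lipschitzWith_legendre hΩ.isCompact hΩ.nonempty.closure hv
  let S : ℕ → Set (Euc n) := fun k =>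
    {p | legendre (closure Ω) v p ≤ inner ℝ p x₁ - v x₁ + 1 / ((k : ℝ) + 1)}
  have hSclosed : ∀ k, IsClosed (S k) := fun k =>
    isClosed_le hC.continuous (by fun_prop)
  have hSanti : Antitone S := fun i j hij p hp => by
    have : 1 / ((j : ℝ) + 1) ≤ 1 / ((i : ℝ) + 1) := Nat.one_div_le_one_div hij
    have h1 : legendre (closure Ω) v p ≤ inner ℝ p x₁ - v x₁ + 1 / ((j : ℝ) + 1) := hp
    have h2 : legendre (closure Ω) v p ≤ inner ℝ p x₁ - v x₁ + 1 / ((i : ℝ) + 1) := by linarith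
    exact h2
  have hSfin : volume (S 0) ≠ ∞ := by
    obtain ⟨δ, hδ, hball⟩ := Metric.isOpen_iff.1 hΩ.isOpen x₁ hx₁
    obtain ⟨M, hM⟩ := hΩ.isCompact.bddAbove_image hv
    have hsub : S 0 ⊆ Metric.closedBall 0 ((M - v x₁ + 1) / (δ / 2)) := fun p hp => by
      rw [mem_closedBall_zero_iff, le_div_iff₀ (by positivity)]
      refine norm_mul_half_le_of_inner_le hδ hball fun y hy => ?_
      have h1 : legendre (closure Ω) v p ≤ inner ℝ p x₁ - v x₁ + 1 / (((0 : ℕ) : ℝ) + 1) := hp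
      have h2 := le_legendre hΩ.isCompact hv p (subset_closure hy)
      have h3 : v y ≤ M := hM ⟨y, subset_closure hy, rfl⟩
      rw [inner_sub_right]
      norm_num at h1
      linarith
    exact ((measure_mono hsub).trans_lt measure_closedBall_lt_top).ne
  have hinter : ⋂ k, S k = subdifferential Ω v x₁ := by
    ext p
    rw [mem_iInter, mem_subdifferential_iff hv]
    constructor
    · intro h y hy
      have h1 : legendre (closure Ω) v p ≤ inner ℝ p x₁ - v x₁ + 0 :=
        ge_of_tendsto' (tendsto_one_div_add_atTop_nhds_zero_nat.const_add _) h
      linarith [le_legendre hΩ.isCompact hv p hy]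
    · intro h k
      have h1 := legendre_le hΩ.isCompact hΩ.nonempty.closure hv h
      have h2 : (0 : ℝ) < 1 / ((k : ℝ) + 1) := Nat.one_div_pos_of_nat
      have h3 : legendre (closure Ω) v p ≤ inner ℝ p x₁ - v x₁ + 1 / ((k : ℝ) + 1) := by linarith
      exact h3
  have hlim := tendsto_measure_iInter_atTop (μ := volume)
    (fun k => (hSclosed k).measurableSet.nullMeasurableSet) hSanti ⟨0, hSfin⟩
  have hlt : volume (⋂ k, S k) < c := by
    rw [hinter]
    simpa [mongeAmpere] using hc
  obtain ⟨k, hk⟩ := (hlim.eventually (gt_mem_nhds hlt)).exists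
  refine ⟨1 / ((k : ℝ) + 1), Nat.one_div_pos_of_nat, ?_, hk⟩
  rw [div_le_one (by positivity)]
  linarith [Nat.cast_nonneg (α := ℝ) k]

/-- The least function with Monge–Ampère measure at most `ν` charges each point with the full mass
of `ν` there: otherwise cutting it with a steep cone with vertex slightly below its graph would
give a smaller one. -/
theorem measure_singleton_le_mongeAmpere [Nontrivial (Euc n)] (hΩ : ConvexDomain Ω)
    {φ : Euc n → ℝ} (hφ : ContinuousOn φ (closure Ω)) (hφc : ConvexOn ℝ (closure Ω) φ)
    {ν : Measure (Euc n)} (hν : ν Ω < ∞) {v : Euc n → ℝ} (hv : v ∈ admissible Ω ν φ 0)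
    (hleast : ∀ w ∈ admissible Ω ν φ 0, ∀ x ∈ closure Ω, v x ≤ w x) {x₁ : Euc n} (hx₁ : x₁ ∈ Ω)
    (hv1 : 1 ≤ v x₁) : ν {x₁} ≤ mongeAmpere Ω v {x₁} := by
  by_contra! hlt
  obtain ⟨ε, hε, hε1, hvol⟩ := exists_volume_approx_subdifferential_lt hΩ hv.1 hx₁ hlt
  obtain ⟨δ, hδ, hball⟩ := Metric.isOpen_iff.1 hΩ.isOpen x₁ hx₁
  obtain ⟨M, hM⟩ := hΩ.isCompact.bddAbove_image hv.1
  have hMv : ∀ x ∈ closure Ω, v x ≤ M := fun x hx => hM ⟨x, hx, rfl⟩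
  have hM0 : 0 ≤ M := by linarith [hMv x₁ (subset_closure hx₁)]
  -- steep enough for the cone to lie above `v` on the boundary
  set Λ := M / δ with hΛdef
  have hΛ : 0 ≤ Λ := by positivity
  set κ : Euc n → ℝ := fun x => v x₁ - ε + Λ * ‖x - x₁‖ with hκ
  have hκc : Continuous κ := by fun_prop
  have hκ0 : ∀ x, 0 ≤ κ x := fun x => by
    have : 0 ≤ Λ * ‖x - x₁‖ := by positivity
    simp only [hκ]
    linarith
  have hκb : ∀ x ∈ frontier Ω, v x ≤ κ x := fun x hx => by
    have h1 : δ ≤ ‖x - x₁‖ := by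
      by_contra! h
      exact (hΩ.mem_frontier.1 hx).2 (hball (by rwa [Metric.mem_ball, dist_eq_norm]))
    have h2 : Λ * δ ≤ Λ * ‖x - x₁‖ := by gcongr
    rw [hΛdef, div_mul_cancel₀ _ hδ.ne', ← hΛdef] at h2
    simp only [hκ]
    linarith [hMv x (frontier_subset_closure hx)]
  set u : Euc n → ℝ := fun x => min (v x) (κ x) with hu
  have hux₁ : u x₁ = v x₁ - ε := by
    simp only [hu, hκ, sub_self, norm_zero, mul_zero, add_zero]
    exact min_eq_right (by linarith)
  have huc : ContinuousOn u (closure Ω) := hv.1.inf hκc.continuousOn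
  have hsup : u ∈ supersolution Ω ν φ 0 := by
    refine ⟨huc, fun x hx => le_min (hv.2.2.1 x hx) (hκ0 x), fun x hx => ?_, fun E hE hEΩ => ?_⟩
    · rw [← hv.2.2.2.1 x hx]
      exact min_eq_left (hκb x hx)
    set A := (fun x => v x - κ x) ⁻¹' Iic 0 with hA
    have hEd : MeasurableSet (E \ {x₁}) := hE.diff (measurableSet_singleton _)
    have hEdΩ : E \ {x₁} ⊆ Ω := sdiff_subset.trans hEΩ
    have hEA : MeasurableSet ((E \ {x₁}) ∩ A) := measurableSet_inter_preimage hΩ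
      (hv.1.sub hκc.continuousOn) hEd hEdΩ measurableSet_Iic
    have h1 : mongeAmpere Ω u (E ∩ {x₁}) ≤ ν (E ∩ {x₁}) := by
      by_cases hxE : x₁ ∈ E
      · rw [inter_eq_right.2 (singleton_subset_iff.2 hxE)]
        refine le_trans (measure_mono fun p hp => ?_) hvol.le
        simp only [mem_singleton_iff, iUnion_iUnion_eq_left] at hp
        rw [mem_subdifferential_iff huc] at hp
        refine legendre_le hΩ.isCompact hΩ.nonempty.closure hv.1 fun y hy => ?_
        have h3 := hp y hy
        rw [hux₁] at h3
        have h4 : u y ≤ v y := min_le_left _ _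
        linarith
      · rw [inter_singleton_eq_empty.2 hxE]
        simp [mongeAmpere]
    have h2 : mongeAmpere Ω u ((E \ {x₁}) ∩ A) ≤ ν (E \ {x₁}) := by
      refine (mongeAmpere_le_of_touching (w := v) (fun x _ => min_le_left _ _) fun x hx =>
        min_eq_left (sub_nonpos.1 hx.2)).trans ?_
      refine (hv.2.2.2.2 _ hEA (inter_subset_left.trans hEdΩ)).trans ?_
      rw [powMeasure_zero_apply hEA]
      exact measure_mono inter_subset_left
    have h3 : mongeAmpere Ω u ((E \ {x₁}) \ A) = 0 := by
      refine le_antisymm ((mongeAmpere_le_of_touching (w := κ) (fun x _ => min_le_right _ _)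
        fun x hx => min_eq_right (le_of_lt (sub_pos.1 (not_le.1 hx.2)))).trans ?_) zero_le
      rw [← Measure.addHaar_sphere volume (0 : Euc n) Λ]
      refine measure_mono fun p hp => ?_
      obtain ⟨x, hx, hpx⟩ := mem_iUnion₂.1 hp
      rw [mem_sphere_zero_iff_norm]
      exact norm_eq_of_mem_subdifferential_cone hΩ hx₁ (hEdΩ hx.1) hx.1.2 hΛ hpx
    rw [powMeasure_zero_apply hE]
    calc mongeAmpere Ω u E
        ≤ mongeAmpere Ω u (E ∩ {x₁}) + mongeAmpere Ω u (E \ {x₁}) :=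
          mongeAmpere_le_inter_add_diff _ _
      _ ≤ mongeAmpere Ω u (E ∩ {x₁}) + (mongeAmpere Ω u ((E \ {x₁}) ∩ A) +
          mongeAmpere Ω u ((E \ {x₁}) \ A)) := by
          gcongr; exact mongeAmpere_le_inter_add_diff _ _
      _ ≤ ν (E ∩ {x₁}) + (ν (E \ {x₁}) + 0) := by gcongr; exact h3.le
      _ = ν E := by rw [add_zero, measure_inter_add_sdiff _ (measurableSet_singleton _)]
  have h1 := hleast _ (envelope_mem_admissible hΩ hφ hφc hν le_rfl hsup) x₁ (subset_closure hx₁)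
  have h2 := envelope_le hΩ hν le_rfl hsup (subset_closure hx₁)
  rw [hux₁] at h2
  linarith

theorem mongeAmpere_sub_const (w : Euc n → ℝ) (c : ℝ) (E : Set (Euc n)) :
    mongeAmpere Ω (fun x => w x - c) E = mongeAmpere Ω w E := by
  have : ∀ x, subdifferential Ω (fun x => w x - c) x = subdifferential Ω w x := fun x => by
    ext p
    exact forall₂_congr fun y _ => by constructor <;> intro h <;> linarith
  simp only [mongeAmpere, this]

/-- Solution of the Dirichlet problem for a measure carried by finitely many points. -/
theorem exists_dirichlet_of_finite [Nontrivial (Euc n)] (hΩ : ConvexDomain Ω)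
    {ψ : Euc n → ℝ} (hψ : ContinuousOn ψ (closure Ω)) (hψc : ConvexOn ℝ (closure Ω) ψ)
    {ν : Measure (Euc n)} (hν : ν Ω < ∞) (F : Finset (Euc n)) (hF : ν (Ω \ F) = 0) :
    ∃ w : Euc n → ℝ, ContinuousOn w (closure Ω) ∧ ConvexOn ℝ (closure Ω) w ∧
      (∀ x ∈ frontier Ω, w x = ψ x) ∧
      ∀ E, MeasurableSet E → E ⊆ Ω → mongeAmpere Ω w E = ν E := by
  obtain ⟨C, hC⟩ := hΩ.isCompact.exists_bound_of_continuousOn hψ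
  obtain ⟨D, hD0, hD⟩ := hΩ.exists_diam
  obtain ⟨ρ, hρ, hρν⟩ := exists_volume_ball_gt (n := n) hν
  -- with this constant added to the boundary values, admissible functions are at least `1`
  set c := C + ρ * D + 1 with hc
  have hψC : ∀ x ∈ closure Ω, -C ≤ ψ x := fun x hx => (abs_le.1 (hC x hx)).1
  set φ : Euc n → ℝ := fun x => ψ x + c with hφdef
  have hφ : ContinuousOn φ (closure Ω) := hψ.add continuousOn_const
  have hφc : ConvexOn ℝ (closure Ω) φ := hψc.add_const c
  have hφ1 : ∀ x ∈ closure Ω, ρ * D + 1 ≤ φ x := fun x hx => by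
    simp only [hφdef]; linarith [hψC x hx]
  have hρD : 0 < ρ * D := by positivity
  obtain ⟨v, hv, hleast⟩ := exists_least_admissible (μ := ν) (q := 0) hΩ hφ hφc
    (fun x hx => by linarith [hφ1 x (frontier_subset_closure hx)]) hν le_rfl
  have hle : ∀ E, MeasurableSet E → E ⊆ Ω → mongeAmpere Ω v E ≤ ν E := fun E hE hEΩ => by
    rw [← powMeasure_zero_apply (w := v) hE]
    exact hv.2.2.2.2 E hE hEΩ
  have hv1 : ∀ x ∈ Ω, 1 ≤ v x := fun x hx => by
    by_contra! h1
    have h2 := volume_ball_le_of_depth hΩ hφc hv.1 hv.2.2.2.1 hx hD0 hD (d := ρ * D)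
      (by linarith [hφ1 x (subset_closure hx)])
    rw [mul_div_cancel_right₀ _ hD0.ne'] at h2
    exact absurd (h2.trans (hle Ω hΩ.isOpen.measurableSet subset_rfl)) (not_le.2 hρν)
  refine ⟨fun x => v x - c, hv.1.sub continuousOn_const, ?_, fun x hx => ?_, fun E hE hEΩ => ?_⟩
  · exact (hv.2.1.add_const (-c)).congr fun x _ => (sub_eq_add_neg _ _).symm
  · simp only [hv.2.2.2.1 x hx, hφdef, add_sub_cancel_right]
  · rw [mongeAmpere_sub_const]
    refine (hle E hE hEΩ).antisymm ?_
    classical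
    have hEF : ν (E \ F) = 0 := measure_mono_null (sdiff_subset_sdiff_left hEΩ) hF
    have hEF' : E ∩ F = (F.filter (· ∈ E) : Finset (Euc n)) := by
      ext x; simp [and_comm]
    have h1 : ν (E ∩ F) ≤ gradientMeasure Ω v (E ∩ F) := by
      rw [hEF', ← sum_measure_singleton, ← sum_measure_singleton]
      refine Finset.sum_le_sum fun x hx => ?_
      have hxΩ := hEΩ (Finset.mem_filter.1 hx).2
      rw [← mongeAmpere_eq hΩ hv.1 (measurableSet_singleton x) (singleton_subset_iff.2 hxΩ)]
      exact measure_singleton_le_mongeAmpere hΩ hφ hφc hν hv hleast hxΩ (hv1 x hxΩ)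
    calc ν E ≤ ν (E ∩ F) + ν (E \ F) := measure_le_inter_add_sdiff _ _ _
      _ ≤ gradientMeasure Ω v (E ∩ F) := by rw [hEF, add_zero]; exact h1
      _ ≤ gradientMeasure Ω v E := measure_mono inter_subset_left
      _ = mongeAmpere Ω v E := (mongeAmpere_eq hΩ hv.1 hE hEΩ).symm

end

/-! ### The Dirichlet problem for a finite measure -/

section

variable {Ω : Set (Euc n)} {φ : Euc n → ℝ}

/-- A uniformly Lipschitz, pointwise bounded sequence has a pointwise convergent subsequence. -/
theorem exists_subseq_tendsto_of_lipschitz {F : ℕ → Euc n → ℝ} {R : ℝ}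
    (hR : ∀ k p p', |F k p - F k p'| ≤ R * ‖p - p'‖) {a b : Euc n → ℝ}
    (hab : ∀ k p, F k p ∈ Icc (a p) (b p)) :
    ∃ (s : ℕ → ℕ) (L : Euc n → ℝ), StrictMono s ∧
      ∀ p, Tendsto (fun k => F (s k) p) atTop (𝓝 (L p)) := by
  let d : ℕ → Euc n := TopologicalSpace.denseSeq (Euc n)
  have hcpt : IsCompact (Set.univ.pi fun i : ℕ => Icc (a (d i)) (b (d i))) :=
    isCompact_univ_pi fun i => isCompact_Icc
  obtain ⟨G, -, s, hs, hG⟩ := hcpt.tendsto_subseq (x := fun k i => F k (d i))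
    fun k i _ => hab k (d i)
  have hG' : ∀ i, CauchySeq fun k => F (s k) (d i) := fun i =>
    ((tendsto_pi_nhds.1 hG) i).cauchySeq
  have hcauchy : ∀ p, CauchySeq fun k => F (s k) p := fun p => by
    refine Metric.cauchySeq_iff'.2 fun ε hε => ?_
    obtain ⟨i, hi⟩ := (TopologicalSpace.denseRange_denseSeq (Euc n)).exists_dist_lt p
      (by positivity : 0 < ε / (3 * (|R| + 1)))
    obtain ⟨N, hN⟩ := Metric.cauchySeq_iff'.1 (hG' i) (ε / 3) (by positivity)
    have hclose : ∀ k, |F k p - F k (d i)| < ε / 3 := fun k => by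
      refine (hR k p (d i)).trans_lt ?_
      rw [dist_eq_norm] at hi
      calc R * ‖p - d i‖ ≤ (|R| + 1) * ‖p - d i‖ := by
            gcongr; linarith [le_abs_self R]
        _ < (|R| + 1) * (ε / (3 * (|R| + 1))) := by gcongr
        _ = ε / 3 := by field_simp
    refine ⟨N, fun k hk => ?_⟩
    have h1 := hclose (s k)
    have h2 := hclose (s N)
    have h3 := hN k hk
    rw [Real.dist_eq] at h3 ⊢
    rw [abs_lt] at *
    constructor <;> linarith
  choose L hL using fun p => cauchySeq_tendsto_of_complete (hcauchy p)
  exact ⟨s, L, hs, hL⟩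

/-- Weak convergence of the Monge–Ampère measures on compactly supported test functions. Near a
compact subset of `Ω` the slopes stay bounded, which provides the dominating function. -/
theorem ControlledSeq.tendsto_lintegral_comp_gradient {u : ℕ → Euc n → ℝ} {L : Euc n → ℝ}
    (h : ControlledSeq Ω φ u L) (hΩ : ConvexDomain Ω)
    (hφ : ContinuousOn φ (closure Ω)) (hφc : ConvexOn ℝ (closure Ω) φ) {m : ℝ}
    (hm : ∀ k, ∀ x ∈ closure Ω, m ≤ u k x) {f : Euc n → ℝ≥0∞} (hf : Continuous f)
    (hf1 : ∀ x, f x ≤ 1) {C : Set (Euc n)} (hC : IsCompact C) (hCΩ : C ⊆ Ω)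
    (hfC : ∀ x, x ∉ C → f x = 0) :
    Tendsto (fun k => ∫⁻ x, f x ∂gradientMeasure Ω (u k)) atTop
      (𝓝 (∫⁻ x, f x ∂gradientMeasure Ω (conjugate L))) := by
  obtain ⟨H, hHc, -, hH⟩ := h.majorant
  obtain ⟨M, hM⟩ := hΩ.isCompact.bddAbove_image hHc
  obtain ⟨δ, hδ, hδΩ⟩ := hC.exists_cthickening_subset_open hΩ.isOpen hCΩ
  simp_rw [gradientMeasure, lintegral_map hf.measurable (measurable_gradient _)]
  refine tendsto_lintegral_of_dominated_convergence
    ((Metric.closedBall (0 : Euc n) ((M - m) / (δ / 2))).indicator 1)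
    (fun k => hf.measurable.comp (measurable_gradient _)) (fun k => ?_) ?_ ?_
  · filter_upwards [ae_gradient_isMax hΩ (h.cont k)] with p ⟨h1, h2, _⟩
    by_cases hpC : gradient (legendre (closure Ω) (u k)) p ∈ C
    · rw [indicator_of_mem]
      · exact hf1 _
      rw [mem_closedBall_zero_iff, le_div_iff₀ (by positivity)]
      refine norm_mul_half_le_of_inner_le hδ ((Metric.ball_subset_thickening hpC δ).trans
        ((Metric.thickening_subset_cthickening δ C).trans hδΩ)) fun y hy => ?_
      have h3 := h2 y (subset_closure hy)
      have h4 := hm k _ h1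
      have h5 : H y ≤ M := hM ⟨y, subset_closure hy, rfl⟩
      have h6 := hH k y (subset_closure hy)
      rw [inner_sub_right]
      linarith
    · rw [hfC _ hpC]
      exact zero_le
  · rw [lintegral_indicator_one Metric.isClosed_closedBall.measurableSet]
    exact measure_closedBall_lt_top.ne
  · filter_upwards [h.ae_tendsto_gradient hΩ hφ hφc] with p hp
    exact (hf.tendsto _).comp hp

/-- Two measures, finite on an open set, coincide there if they give the same integral to the
thickened indicators of its compact subsets. -/
theorem measure_eq_of_lintegral_thickenedIndicator_eq {σ τ : Measure (Euc n)} (hΩ : IsOpen Ω)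
    (hσ : σ Ω < ∞) (hτ : τ Ω < ∞)
    (h : ∀ C : Set (Euc n), IsCompact C → ∀ (δ : ℝ) (hδ : 0 < δ), Metric.cthickening δ C ⊆ Ω →
      ∫⁻ x in Ω, thickenedIndicator hδ C x ∂σ = ∫⁻ x in Ω, thickenedIndicator hδ C x ∂τ)
    {E : Set (Euc n)} (hE : MeasurableSet E) (hEΩ : E ⊆ Ω) : σ E = τ E := by
  have hσf : IsFiniteMeasure (σ.restrict Ω) := ⟨by rwa [Measure.restrict_apply_univ]⟩
  have hτf : IsFiniteMeasure (τ.restrict Ω) := ⟨by rwa [Measure.restrict_apply_univ]⟩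
  have hcpt : ∀ C : Set (Euc n), IsCompact C → C ⊆ Ω → σ.restrict Ω C = τ.restrict Ω C := by
    intro C hC hCΩ
    obtain ⟨δ, hδ, hδΩ⟩ := hC.exists_cthickening_subset_open hΩ hCΩ
    have hpos : ∀ k : ℕ, 0 < δ / ((k : ℝ) + 1) := fun k => by positivity
    have hlim : Tendsto (fun k : ℕ => δ / ((k : ℝ) + 1)) atTop (𝓝 0) :=
      tendsto_const_div_atTop_nhds_zero_nat δ |>.comp (tendsto_add_atTop_nat 1) |>.congr
        fun k => by simp
    have h1 := tendsto_lintegral_thickenedIndicator_of_isClosed (σ.restrict Ω) hC.isClosed hpos hlim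
    have h2 := tendsto_lintegral_thickenedIndicator_of_isClosed (τ.restrict Ω) hC.isClosed hpos hlim
    refine tendsto_nhds_unique h1 (h2.congr fun k => (h C hC _ (hpos k) ?_).symm)
    refine (Metric.cthickening_mono ?_ C).trans hδΩ
    exact div_le_self hδ.le (by linarith [Nat.cast_nonneg (α := ℝ) k])
  have h1 : σ.restrict Ω E = τ.restrict Ω E := by
    rw [hE.measure_eq_iSup_isCompact_of_ne_top (measure_ne_top _ _),
      hE.measure_eq_iSup_isCompact_of_ne_top (measure_ne_top _ _)]
    exact iSup_congr fun C => iSup_congr fun hCE => iSup_congr fun hC =>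
      hcpt C hC (hCE.trans hEΩ)
  rwa [Measure.restrict_apply hE, Measure.restrict_apply hE, inter_eq_left.2 hEΩ] at h1

/-- Solution of the Dirichlet problem for a finite measure `ν`, as a limit of the solutions for
finitely supported measures converging weakly to `ν`. -/
theorem exists_dirichlet [Nontrivial (Euc n)] (hΩ : ConvexDomain Ω)
    (hφ : ContinuousOn φ (closure Ω)) (hφc : ConvexOn ℝ (closure Ω) φ)
    {ν : Measure (Euc n)} (hν : ν Ω < ∞) :
    ∃ w : Euc n → ℝ, ContinuousOn w (closure Ω) ∧ ConvexOn ℝ (closure Ω) w ∧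
      (∀ x ∈ frontier Ω, w x = φ x) ∧
      ∀ E, MeasurableSet E → E ⊆ Ω → mongeAmpere Ω w E = ν E := by
  obtain ⟨z, hz⟩ := hΩ.nonempty
  obtain ⟨R, hR⟩ := hΩ.isCompact.isBounded.exists_norm_le
  obtain ⟨C, hC⟩ := hΩ.isCompact.exists_bound_of_continuousOn hφ
  obtain ⟨D, hD0, hD⟩ := hΩ.exists_diam
  obtain ⟨ρ, hρ, hρν⟩ := exists_volume_ball_gt (n := n) hν
  have hΩm := hΩ.isOpen.measurableSet
  have hφC : ∀ x ∈ closure Ω, -C ≤ φ x ∧ φ x ≤ C := fun x hx => abs_le.1 (hC x hx)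
  set τ := ν.restrict Ω with hτ
  have hτf : IsFiniteMeasure τ := ⟨by rwa [hτ, Measure.restrict_apply_univ]⟩
  let T : ℕ → SimpleFunc (Euc n) (Euc n) := SimpleFunc.approxOn id measurable_id Ω z hz
  have hT : ∀ k x, T k x ∈ Ω := SimpleFunc.approxOn_mem measurable_id hz
  have hTlim : ∀ x ∈ Ω, Tendsto (fun k => T k x) atTop (𝓝 x) := fun x hx =>
    SimpleFunc.tendsto_approxOn measurable_id hz (subset_closure hx)
  have hνk : ∀ k, τ.map (T k) Ω = ν Ω := fun k => by
    rw [Measure.map_apply (T k).measurable hΩm, preimage_eq_univ_iff.2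
      (range_subset_iff.2 (hT k)), hτ, Measure.restrict_apply_univ]
  have hsupp : ∀ k, τ.map (T k) (Ω \ (T k).range) = 0 := fun k => by
    rw [Measure.map_apply (T k).measurable (hΩm.diff (T k).range.finite_toSet.measurableSet)]
    refine measure_mono_null (fun x hx => ?_) measure_empty
    exact (hx.2 (by simp)).elim
  choose w hwc hwconv hwb hwν using fun k =>
    exists_dirichlet_of_finite hΩ hφ hφc ((hνk k).trans_lt hν) (T k).range (hsupp k)
  -- uniform bounds for the approximating solutions
  have hφc' : ∀ x ∈ frontier Ω, φ x ≤ C := fun x hx => (hφC x (frontier_subset_closure hx)).2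
  set H := coneOver Ω φ z C with hHdef
  have hHc : ContinuousOn H (closure Ω) := (continuous_coneOver hΩ hz hφ C).continuousOn
  have hH : ∀ k, ∀ x ∈ closure Ω, w k x ≤ H x := fun k x hx =>
    le_coneOver hΩ hz (hwconv k) (hwb k) hφc' hx
  have hm : ∀ k, ∀ x ∈ closure Ω, -C - ρ * D ≤ w k x := fun k x hx => by
    by_cases hxΩ : x ∈ Ω
    · by_contra! hlt
      have h2 := volume_ball_le_of_depth hΩ hφc (hwc k) (hwb k) hxΩ hD0 hD (d := ρ * D)
        (by linarith [(hφC x hx).1])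
      rw [mul_div_cancel_right₀ _ hD0.ne', hwν k Ω hΩm subset_rfl, hνk] at h2
      exact absurd h2 (not_le.2 hρν)
    · rw [hwb k x (hΩ.mem_frontier.2 ⟨hx, hxΩ⟩)]
      have : 0 < ρ * D := by positivity
      linarith [(hφC x hx).1]
  obtain ⟨s, L, hs, hL⟩ := exists_subseq_tendsto_of_lipschitz
    (F := fun k => legendre (closure Ω) (w k)) (R := R)
    (fun k => abs_legendre_sub_le hΩ.isCompact hΩ.nonempty.closure (hwc k) hR)
    (a := fun p => inner ℝ p z - H z) (b := fun p => ‖p‖ * R + (C + ρ * D)) fun k p => by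
      refine ⟨?_, legendre_le hΩ.isCompact hΩ.nonempty.closure (hwc k) fun x hx => ?_⟩
      · exact le_trans (by linarith [hH k z (subset_closure hz)])
          (le_legendre hΩ.isCompact (hwc k) p (subset_closure hz))
      · have h1 : inner ℝ p x ≤ ‖p‖ * R := (real_inner_le_norm p x).trans (by
          gcongr; exact hR x hx)
        linarith [hm k x hx]
  have h : ControlledSeq Ω φ (fun k => w (s k)) L :=
    { cont := fun k => hwc _
      bdry := fun k => hwb _
      majorant := ⟨H, hHc, fun x hx => coneOver_eq_of_mem_frontier hΩ hz C hx, fun k => hH _⟩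
      mass := ⟨ν Ω, hν, fun k => by rw [hwν _ Ω hΩm subset_rfl, hνk]⟩
      tendsto := hL }
  have hvc := h.continuousOn_conjugate hΩ hφ hφc
  refine ⟨conjugate L, hvc, h.convexOn_conjugate hΩ, fun x hx => h.conjugate_eq_bdry hΩ hφ hφc hx,
    fun E hE hEΩ => ?_⟩
  rw [mongeAmpere_eq hΩ hvc hE hEΩ]
  refine measure_eq_of_lintegral_thickenedIndicator_eq hΩ.isOpen ?_ hν (fun A hA δ hδ hAδ => ?_)
    hE hEΩ
  · rw [← mongeAmpere_eq hΩ hvc hΩm subset_rfl]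
    refine (h.mongeAmpere_le_liminf hΩ hφ hφc hΩ.isOpen subset_rfl).trans_lt ?_
    simpa [hwν _ Ω hΩm subset_rfl, hνk] using hν
  -- both integrals are limits of the integrals for the approximating problems
  set f : Euc n → ℝ≥0∞ := fun x => thickenedIndicator hδ A x with hf
  have hfc : Continuous f := ENNReal.continuous_coe.comp (thickenedIndicator hδ A).continuous
  have hf1 : ∀ x, f x ≤ 1 := fun x => by
    simp only [hf]
    exact_mod_cast thickenedIndicator_le_one hδ A x
  have hf0 : ∀ x, x ∉ Metric.cthickening δ A → f x = 0 := fun x hx => by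
    simp only [hf, ENNReal.coe_eq_zero]
    exact thickenedIndicator_zero hδ A fun h' => hx (Metric.thickening_subset_cthickening δ A h')
  have hind : ∀ σ : Measure (Euc n), ∫⁻ x in Ω, f x ∂σ = ∫⁻ x, f x ∂σ := fun σ =>
    setLIntegral_eq_of_support_subset fun x hx => by
      by_contra hxΩ
      exact hx (hf0 x fun h' => hxΩ (hAδ h'))
  have hlim1 := h.tendsto_lintegral_comp_gradient hΩ hφ hφc (fun k => hm _) hfc hf1
    hA.cthickening hAδ hf0
  have hlim2 : Tendsto (fun k => ∫⁻ x, f x ∂(τ.map (T (s k)))) atTop (𝓝 (∫⁻ x, f x ∂τ)) := by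
    simp_rw [lintegral_map hfc.measurable (T _).measurable]
    refine tendsto_lintegral_of_dominated_convergence (fun _ => 1)
      (fun k => hfc.measurable.comp (T _).measurable)
      (fun k => Eventually.of_forall fun x => hf1 _) (by simp) ?_
    filter_upwards [ae_restrict_mem hΩm] with x hx
    exact (hfc.tendsto _).comp ((hTlim x hx).comp hs.tendsto_atTop)
  have heq : ∀ k, ∫⁻ x, f x ∂gradientMeasure Ω (w (s k)) = ∫⁻ x, f x ∂(τ.map (T (s k))) := by
    intro k
    rw [← hind, ← hind (τ.map _)]
    congr 1
    ext B hB
    rw [Measure.restrict_apply hB, Measure.restrict_apply hB,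
      ← mongeAmpere_eq hΩ (hwc _) (hB.inter hΩm) inter_subset_right,
      hwν _ _ (hB.inter hΩm) inter_subset_right]
  simp_rw [heq] at hlim1
  rw [hind]
  exact tendsto_nhds_unique hlim1 hlim2

end

/-! ### The equation on the positivity set -/

section

variable {Ω : Set (Euc n)} {φ : Euc n → ℝ} {μ : Measure (Euc n)} {q : ℝ}

/-- Of two functions with the same boundary values, the smaller one has the larger total
Monge–Ampère mass. -/
theorem mongeAmpere_domain_le_of_le (hΩ : ConvexDomain Ω) {v w : Euc n → ℝ}
    (hv : ContinuousOn v (closure Ω)) (hw : ContinuousOn w (closure Ω))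
    (hb : ∀ x ∈ frontier Ω, w x = v x) (hle : ∀ x ∈ closure Ω, v x ≤ w x) :
    mongeAmpere Ω w Ω ≤ mongeAmpere Ω v Ω := by
  refine measure_mono fun p hp => ?_
  obtain ⟨x₀, hx₀, hp₀⟩ := mem_iUnion₂.1 hp
  rw [mem_subdifferential_iff hw] at hp₀
  obtain ⟨x, hx, -, hmax⟩ := exists_legendre_eq hΩ.isCompact hΩ.nonempty.closure hv p
  by_cases hxΩ : x ∈ Ω
  · exact mem_iUnion₂.2 ⟨x, hxΩ, (mem_subdifferential_iff hv).2 hmax⟩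
  · refine mem_iUnion₂.2 ⟨x₀, hx₀, (mem_subdifferential_iff hv).2 fun y hy => ?_⟩
    have h1 := hb x (hΩ.mem_frontier.2 ⟨hx, hxΩ⟩)
    linarith [hmax y hy, hp₀ x hx, hle x₀ (subset_closure hx₀)]

/-- For a convex function, a local subgradient is a global one. -/
theorem subdifferential_subset_of_convexOn {B : Set (Euc n)} (hB : IsOpen B) (hBΩ : B ⊆ Ω)
    {v : Euc n → ℝ} (hv : ConvexOn ℝ Ω v) {x : Euc n} (hx : x ∈ B) :
    subdifferential B v x ⊆ subdifferential Ω v x := by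
  intro p hp y hy
  have hlim : Tendsto (fun t : ℝ => x + t • (y - x)) (𝓝[>] 0) (𝓝 x) := by
    have h1 : Continuous fun t : ℝ => x + t • (y - x) := by fun_prop
    have h2 := (h1.tendsto 0).mono_left (nhdsWithin_le_nhds (s := Ioi 0))
    simpa using h2
  obtain ⟨t, htB, ht⟩ :=
    ((hlim.eventually (hB.mem_nhds hx)).and (Ioc_mem_nhdsGT (zero_lt_one' ℝ))).exists
  have h1 := hp _ htB
  have h2 := hv.2 (hBΩ hx) hy (sub_nonneg.2 ht.2) ht.1.le (by ring)
  rw [show (1 - t) • x + t • y = x + t • (y - x) by module, smul_eq_mul, smul_eq_mul] at h2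
  rw [add_sub_cancel_left, inner_smul_right] at h1
  have h3 : t * (v x + inner ℝ p (y - x)) ≤ t * v y := by linarith
  exact le_of_mul_le_mul_left h3 ht.1

theorem convexDomain_ball {x₀ : Euc n} {r : ℝ} (hr : 0 < r) : ConvexDomain (Metric.ball x₀ r) :=
  ⟨Metric.isOpen_ball, convex_ball x₀ r, Metric.isBounded_ball, Metric.nonempty_ball.2 hr⟩

/-- Replacing an admissible function `v` inside a ball by the minimum with a function `w`, where
`w` has the boundary values of `v` on the ball and a Monge–Ampère measure `c μ` with `c` at most
`w ^ q` wherever `w < v`, gives a supersolution. -/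
theorem glue_mem_supersolution (hΩ : ConvexDomain Ω) (hq : 0 ≤ q) {v w : Euc n → ℝ}
    (hv : v ∈ admissible Ω μ φ q) {x₀ : Euc n} {r : ℝ}
    (hrΩ : Metric.closedBall x₀ r ⊆ Ω) (hw : ContinuousOn w (Metric.closedBall x₀ r))
    (hwb : ∀ x ∈ Metric.sphere x₀ r, w x = v x) (hw0 : ∀ x ∈ Metric.closedBall x₀ r, 0 ≤ w x)
    {c : ℝ} (hwμ : ∀ E, MeasurableSet E → E ⊆ Metric.ball x₀ r →
      mongeAmpere (Metric.ball x₀ r) w E = ENNReal.ofReal c * μ E)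
    (hc : ∀ x ∈ Metric.ball x₀ r, w x < v x → c ≤ w x ^ q) :
    ∃ u ∈ supersolution Ω μ φ q, ∀ x ∈ Metric.closedBall x₀ r, u x ≤ w x := by
  classical
  set B := Metric.ball x₀ r with hB
  set u : Euc n → ℝ := (Metric.closedBall x₀ r).piecewise (fun x => min (v x) (w x)) v with hu
  have hu1 : ∀ x ∈ Metric.closedBall x₀ r, u x = min (v x) (w x) := fun x hx =>
    piecewise_eq_of_mem _ _ _ hx
  have hu2 : ∀ x, x ∉ B → u x = v x := fun x hx => by
    by_cases hxc : x ∈ Metric.closedBall x₀ r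
    · have : x ∈ Metric.sphere x₀ r :=
        le_antisymm (Metric.mem_closedBall.1 hxc) (not_lt.1 fun h => hx (Metric.mem_ball.2 h))
      rw [hu1 x hxc, hwb x this, min_self]
    · exact piecewise_eq_of_notMem _ _ _ hxc
  have huv : ∀ x, u x ≤ v x := fun x => by
    by_cases hxc : x ∈ Metric.closedBall x₀ r
    · rw [hu1 x hxc]; exact min_le_left _ _
    · exact (piecewise_eq_of_notMem _ _ _ hxc).le
  have hBc : B ⊆ Metric.closedBall x₀ r := Metric.ball_subset_closedBall
  have huc : ContinuousOn u (closure Ω) := by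
    have h1 : ContinuousOn u (Metric.closedBall x₀ r) :=
      ((hv.1.mono (hrΩ.trans subset_closure)).inf hw).congr hu1
    have h2 : ContinuousOn u (closure Ω \ B) :=
      (hv.1.mono sdiff_subset).congr fun x hx => hu2 x hx.2
    refine (h1.union_of_isClosed h2 Metric.isClosed_closedBall
      (isClosed_closure.sdiff Metric.isOpen_ball)).mono fun x hx => ?_
    by_cases hxB : x ∈ B
    · exact Or.inl (hBc hxB)
    · exact Or.inr ⟨hx, hxB⟩
  refine ⟨u, ⟨huc, fun x hx => ?_, fun x hx => ?_, fun E hE hEΩ => ?_⟩, fun x hx => by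
    rw [hu1 x hx]; exact min_le_right _ _⟩
  · by_cases hxB : x ∈ B
    · rw [hu1 x (hBc hxB)]
      exact le_min (hv.2.2.1 x hx) (hw0 x (hBc hxB))
    · rw [hu2 x hxB]
      exact hv.2.2.1 x hx
  · rw [hu2 x fun h => (hΩ.mem_frontier.1 hx).2 (hrΩ (hBc h)), hv.2.2.2.1 x hx]
  set A := (fun x => u x - v x) ⁻¹' {0} with hA
  have h1 : MeasurableSet (E ∩ A) :=
    measurableSet_inter_preimage hΩ (huc.sub hv.1) hE hEΩ (measurableSet_singleton 0)
  have h2 : MeasurableSet (E \ A) := by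
    rw [← sdiff_self_inter]
    exact hE.diff h1
  have e1 : ∀ x ∈ E ∩ A, u x = v x := fun x hx => sub_eq_zero.1 hx.2
  have e2 : ∀ x ∈ E \ A, x ∈ B ∧ u x = w x ∧ w x < v x := fun x hx => by
    have hne : u x ≠ v x := fun h => hx.2 (sub_eq_zero.2 h)
    have hxB : x ∈ B := by
      by_contra h
      exact hne (hu2 x h)
    have h3 := hu1 x (hBc hxB)
    rcases le_total (v x) (w x) with h4 | h4
    · rw [min_eq_left h4] at h3
      exact (hne h3).elim
    · rw [min_eq_right h4] at h3
      exact ⟨hxB, h3, lt_of_le_of_ne h4 fun h5 => hne (h3.trans h5)⟩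
  have hd1 : mongeAmpere Ω u (E ∩ A) ≤ powMeasure u q μ (E ∩ A) := by
    refine (mongeAmpere_le_of_touching (fun x _ => huv x) e1).trans
      ((hv.2.2.2.2 _ h1 (inter_subset_left.trans hEΩ)).trans ?_)
    exact powMeasure_mono h1 hq (fun x hx => hv.2.2.1 x (subset_closure (hEΩ hx.1)))
      fun x hx => (e1 x hx).ge
  have hd2 : mongeAmpere Ω u (E \ A) ≤ powMeasure u q μ (E \ A) := by
    have h3 : mongeAmpere Ω u (E \ A) ≤ mongeAmpere B w (E \ A) := by
      refine measure_mono (biUnion_mono subset_rfl fun x hx p hp y hy => ?_)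
      rw [← (e2 x hx).2.1]
      refine (hp y (hrΩ (hBc hy))).trans ?_
      rw [hu1 y (hBc hy)]
      exact min_le_right _ _
    refine h3.trans ?_
    rw [hwμ _ h2 fun x hx => (e2 x hx).1, powMeasure_apply h2, ← setLIntegral_const]
    refine setLIntegral_mono' h2 fun x hx => ENNReal.ofReal_le_ofReal ?_
    rw [(e2 x hx).2.1]
    exact hc x (e2 x hx).1 (e2 x hx).2.2
  calc mongeAmpere Ω u E ≤ mongeAmpere Ω u (E ∩ A) + mongeAmpere Ω u (E \ A) :=
        mongeAmpere_le_inter_add_diff E A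
    _ ≤ powMeasure u q μ (E ∩ A) + powMeasure u q μ (E \ A) := add_le_add hd1 hd2
    _ = powMeasure u q μ E := by
        have h3 := measure_inter_add_sdiff (μ := powMeasure u q μ) E h1
        rwa [sdiff_self_inter, ← inter_assoc, inter_self] at h3

/-- On small balls around a point where the least admissible function is positive, its
Monge–Ampère measure is almost as large as `v ^ q μ`. Otherwise the solution of the Dirichlet
problem on the ball with constant density slightly below `v ^ q` would drop below `v` there. -/
theorem eventually_powMeasure_ball_le [Nontrivial (Euc n)] (hΩ : ConvexDomain Ω)
    (hφ : ContinuousOn φ (closure Ω)) (hφc : ConvexOn ℝ (closure Ω) φ) (hμ : μ Ω < ∞) (hq : 0 ≤ q)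
    {v : Euc n → ℝ} (hv : v ∈ admissible Ω μ φ q)
    (hleast : ∀ w ∈ admissible Ω μ φ q, ∀ x ∈ closure Ω, v x ≤ w x) {x₀ : Euc n} (hx₀ : x₀ ∈ Ω)
    (hpos : 0 < v x₀) {κ : ℝ} (hκ0 : 0 < κ) (hκ1 : κ < 1) :
    ∀ᶠ r in 𝓝[>] (0 : ℝ), Metric.closedBall x₀ r ⊆ Ω ∧
      ENNReal.ofReal (κ ^ 2) * powMeasure v q μ (Metric.ball x₀ r) ≤
        mongeAmpere Ω v (Metric.ball x₀ r) := by
  set a := v x₀ with ha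
  have haq : 0 < a ^ q := Real.rpow_pos_of_pos hpos q
  -- `v` varies by at most `η` on the ball and `w` is within `η` below `v`, hence `3 * η`
  obtain ⟨η, hη, hηa⟩ : ∃ η > 0, ∀ t : ℝ, |t - a| < 3 * η →
      0 < t ∧ κ * a ^ q < t ^ q ∧ t ^ q < κ⁻¹ * a ^ q := by
    have hcont : Tendsto (fun t : ℝ => t ^ q) (𝓝 a) (𝓝 (a ^ q)) :=
      (Real.continuous_rpow_const hq).tendsto a
    have h1 : ∀ᶠ t in 𝓝 a, 0 < t ∧ κ * a ^ q < t ^ q ∧ t ^ q < κ⁻¹ * a ^ q := by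
      refine (lt_mem_nhds hpos).and ((hcont.eventually (lt_mem_nhds ?_)).and
        (hcont.eventually (gt_mem_nhds ?_)))
      · nlinarith
      · have : 1 < κ⁻¹ := (one_lt_inv₀ hκ0).2 hκ1
        nlinarith
    obtain ⟨η, hη, h2⟩ := Metric.eventually_nhds_iff.1 h1
    exact ⟨η / 3, by positivity, fun t ht => h2 (by rw [Real.dist_eq]; linarith)⟩
  set c := κ * a ^ q with hc
  have hcμ : ENNReal.ofReal c * μ Ω < ∞ := ENNReal.mul_lt_top ENNReal.ofReal_lt_top hμ
  obtain ⟨ρ, hρ, hρμ⟩ := exists_volume_ball_gt (n := n) hcμ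
  have hnear : ∀ᶠ y in 𝓝 x₀, y ∈ Ω ∧ |v y - a| < η := by
    have h1 : ContinuousAt v x₀ :=
      (hv.1.mono subset_closure).continuousAt (hΩ.isOpen.mem_nhds hx₀)
    filter_upwards [hΩ.isOpen.mem_nhds hx₀, h1.eventually (Metric.ball_mem_nhds _ hη)] with y hy hy'
    exact ⟨hy, hy'⟩
  obtain ⟨r₀, hr₀, hball⟩ := Metric.eventually_nhds_iff.1 hnear
  filter_upwards [Ioo_mem_nhdsGT (lt_min hr₀ (by positivity : 0 < η / (2 * ρ)))] with r hr
  have hrpos : 0 < r := hr.1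
  have hclosed : ∀ y ∈ Metric.closedBall x₀ r, y ∈ Ω ∧ |v y - a| < η := fun y hy =>
    hball ((Metric.mem_closedBall.1 hy).trans_lt (hr.2.trans_le (min_le_left _ _)))
  have hrΩ : Metric.closedBall x₀ r ⊆ Ω := fun y hy => (hclosed y hy).1
  refine ⟨hrΩ, ?_⟩
  have hB := convexDomain_ball (x₀ := x₀) hrpos
  have hBcl : closure (Metric.ball x₀ r) = Metric.closedBall x₀ r := closure_ball x₀ hrpos.ne'
  have hBfr : frontier (Metric.ball x₀ r) = Metric.sphere x₀ r := frontier_ball x₀ hrpos.ne'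
  have hBΩ : Metric.ball x₀ r ⊆ Ω := Metric.ball_subset_closedBall.trans hrΩ
  have hBm : MeasurableSet (Metric.ball x₀ r) := Metric.isOpen_ball.measurableSet
  have hvcB : ContinuousOn v (closure (Metric.ball x₀ r)) := by
    rw [hBcl]; exact hv.1.mono (hrΩ.trans subset_closure)
  have hvconvB : ConvexOn ℝ (closure (Metric.ball x₀ r)) v := by
    rw [hBcl]; exact hv.2.1.subset (hrΩ.trans subset_closure) (convex_closedBall x₀ r)
  have hνle : ∀ E, E ⊆ Ω → (ENNReal.ofReal c • μ) E ≤ ENNReal.ofReal c * μ Ω := fun E hE => by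
    rw [Measure.smul_apply, smul_eq_mul]
    gcongr
  obtain ⟨w, hwc, -, hwb, hwν⟩ := exists_dirichlet hB hvcB hvconvB
    (ν := ENNReal.ofReal c • μ) ((hνle _ hBΩ).trans_lt hcμ)
  -- the mass of the ball is too small for `w` to descend by more than `η` below `v`
  have hdepth : ∀ x ∈ Metric.closedBall x₀ r, v x - η ≤ w x := fun x hx => by
    by_cases hxB : x ∈ Metric.ball x₀ r
    · by_contra! hlt
      have hdiam : ∀ y ∈ closure (Metric.ball x₀ r), ∀ z ∈ closure (Metric.ball x₀ r),
          ‖y - z‖ ≤ 2 * r := fun y hy z hz => by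
        rw [hBcl] at hy hz
        rw [← dist_eq_norm]
        linarith [dist_triangle_right y z x₀, Metric.mem_closedBall.1 hy, Metric.mem_closedBall.1 hz]
      have h1 := volume_ball_le_of_depth hB hvconvB hwc hwb hxB (by positivity) hdiam (d := η)
        (by linarith)
      rw [hwν _ hBm subset_rfl] at h1
      have h2 : ρ ≤ η / (2 * r) := by
        rw [le_div_iff₀ (by positivity)]
        have h3 := (hr.2.trans_le (min_le_right _ _)).le
        rw [le_div_iff₀ (by positivity)] at h3
        linarith
      exact absurd ((measure_mono (Metric.ball_subset_ball h2)).trans (h1.trans (hνle _ hBΩ)))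
        (not_le.2 hρμ)
    · have : x ∈ frontier (Metric.ball x₀ r) := hB.mem_frontier.2 ⟨hBcl ▸ hx, hxB⟩
      rw [hwb x this]
      linarith
  have hwlow : ∀ x ∈ Metric.closedBall x₀ r, a - 2 * η < w x := fun x hx => by
    linarith [hdepth x hx, (abs_lt.1 (hclosed x hx).2).1]
  have hw0 : ∀ x ∈ Metric.closedBall x₀ r, 0 ≤ w x := fun x hx => by
    have h1 := (hηa (a - 2 * η) (by
      rw [abs_lt]; constructor <;> linarith)).1
    linarith [hwlow x hx]
  have hcw : ∀ x ∈ Metric.ball x₀ r, w x < v x → c ≤ w x ^ q := fun x hx hlt => by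
    have hx' := Metric.ball_subset_closedBall hx
    refine (hηa (w x) (abs_lt.2 ⟨?_, ?_⟩)).2.1.le
    · linarith [hwlow x hx']
    · linarith [(abs_lt.1 (hclosed x hx').2).2]
  obtain ⟨u, hu, huw⟩ := glue_mem_supersolution hΩ hq hv hrΩ (hBcl ▸ hwc) (hBfr ▸ hwb) hw0
    (fun E hE hEB => by rw [hwν E hE hEB, Measure.smul_apply, smul_eq_mul]) hcw
  have hvw : ∀ x ∈ closure (Metric.ball x₀ r), v x ≤ w x := fun x hx => by
    rw [hBcl] at hx
    have hxK := subset_closure (hrΩ hx)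
    exact (hleast _ (envelope_mem_admissible hΩ hφ hφc hμ hq hu) x hxK).trans
      ((envelope_le hΩ hμ hq hu hxK).trans (huw x hx))
  calc ENNReal.ofReal (κ ^ 2) * powMeasure v q μ (Metric.ball x₀ r)
      ≤ ENNReal.ofReal (κ ^ 2) * (ENNReal.ofReal (κ⁻¹ * a ^ q) * μ (Metric.ball x₀ r)) := by
        gcongr
        rw [powMeasure_apply hBm, ← setLIntegral_const]
        refine setLIntegral_mono' hBm fun x hx => ENNReal.ofReal_le_ofReal ?_
        refine (hηa (v x) ?_).2.2.le
        linarith [(hclosed x (Metric.ball_subset_closedBall hx)).2]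
    _ = ENNReal.ofReal c * μ (Metric.ball x₀ r) := by
        rw [← mul_assoc, ← ENNReal.ofReal_mul (by positivity)]
        congr 2
        rw [hc]
        field_simp
    _ = mongeAmpere (Metric.ball x₀ r) w (Metric.ball x₀ r) := by
        rw [hwν _ hBm subset_rfl, Measure.smul_apply, smul_eq_mul]
    _ ≤ mongeAmpere (Metric.ball x₀ r) v (Metric.ball x₀ r) :=
        mongeAmpere_domain_le_of_le hB hvcB hwc hwb hvw
    _ ≤ mongeAmpere Ω v (Metric.ball x₀ r) :=
        measure_mono (biUnion_mono subset_rfl fun x hx =>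
          subdifferential_subset_of_convexOn Metric.isOpen_ball hBΩ
            (hv.2.1.subset subset_closure hΩ.convex) hx)

/-- The least admissible function solves the equation where it is positive. The lower bound on
small balls passes to Borel sets by the Besicovitch covering theorem. -/
theorem mongeAmpere_eq_powMeasure_of_pos [Nontrivial (Euc n)] (hΩ : ConvexDomain Ω)
    (hφ : ContinuousOn φ (closure Ω)) (hφc : ConvexOn ℝ (closure Ω) φ) (hμ : μ Ω < ∞) (hq : 0 ≤ q)
    {v : Euc n → ℝ} (hv : v ∈ admissible Ω μ φ q)
    (hleast : ∀ w ∈ admissible Ω μ φ q, ∀ x ∈ closure Ω, v x ≤ w x) {E : Set (Euc n)}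
    (hE : MeasurableSet E) (hEΩ : E ⊆ {x | 0 < v x} ∩ Ω) :
    mongeAmpere Ω v E = powMeasure v q μ E := by
  have hEΩ' : E ⊆ Ω := hEΩ.trans inter_subset_right
  refine (hv.2.2.2.2 E hE hEΩ').antisymm ?_
  have hΩm := hΩ.isOpen.measurableSet
  obtain ⟨M, hM⟩ := hΩ.isCompact.bddAbove_image hv.1
  have hfin : powMeasure v q μ Ω < ∞ :=
    (powMeasure_le_const hΩm hq (fun x hx => hv.2.2.1 x (subset_closure hx))
      fun x hx => hM ⟨x, subset_closure hx, rfl⟩).trans_lt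
      (ENNReal.mul_lt_top ENNReal.ofReal_lt_top hμ)
  set τ := (powMeasure v q μ).restrict Ω with hτ
  set σ := (gradientMeasure Ω v).restrict Ω with hσ
  have hτE : ∀ A, MeasurableSet A → A ⊆ Ω → τ A = powMeasure v q μ A := fun A hA hAΩ => by
    rw [hτ, Measure.restrict_apply hA, inter_eq_left.2 hAΩ]
  have hσE : ∀ A, MeasurableSet A → A ⊆ Ω → σ A = mongeAmpere Ω v A := fun A hA hAΩ => by
    rw [hσ, Measure.restrict_apply hA, inter_eq_left.2 hAΩ, mongeAmpere_eq hΩ hv.1 hA hAΩ]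
  have hτf : IsFiniteMeasure τ := ⟨by rwa [hτ, Measure.restrict_apply_univ]⟩
  have hσf : IsFiniteMeasure σ := ⟨by
    rw [hσ, Measure.restrict_apply_univ, ← mongeAmpere_eq hΩ hv.1 hΩm subset_rfl]
    exact (hv.2.2.2.2 Ω hΩm subset_rfl).trans_lt hfin⟩
  have hκ : ∀ κ ∈ Ioo (0 : ℝ) 1, ENNReal.ofReal (κ ^ 2) * τ E ≤ σ E := fun κ hκ => by
    refine (Besicovitch.vitaliFamily τ).measure_le_of_frequently_le
      (ρ := ENNReal.ofReal (κ ^ 2) • τ) σ Measure.smul_absolutelyContinuous E fun x hx => ?_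
    refine (Besicovitch.tendsto_filterAt τ x).frequently (Eventually.frequently ?_)
    obtain ⟨r₀, hr₀, hr₀'⟩ := mem_nhdsGT_iff_exists_Ioo_subset.1 (eventually_powMeasure_ball_le hΩ
      hφ hφc hμ hq hv hleast (hEΩ hx).2 (hEΩ hx).1 hκ.1 hκ.2)
    filter_upwards [Ioo_mem_nhdsGT hr₀] with r hr
    -- pass from open balls of radius `s > r` to the closed ball of radius `r`
    have hlim := tendsto_measure_biInter_gt (μ := σ) (s := fun s => Metric.closedBall x s) (a := r)
      (fun s _ => Metric.isClosed_closedBall.measurableSet.nullMeasurableSet)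
      (fun s t _ hst => Metric.closedBall_subset_closedBall hst) ⟨r + 1, by linarith, measure_ne_top _ _⟩
    rw [Metric.biInter_gt_closedBall] at hlim
    refine ge_of_tendsto hlim ?_
    filter_upwards [Ioo_mem_nhdsGT hr.2] with s hs
    obtain ⟨hs1, hs2⟩ := hr₀' ⟨hr.1.trans hs.1, hs.2⟩
    have hsΩ : Metric.ball x s ⊆ Ω := Metric.ball_subset_closedBall.trans hs1
    calc (ENNReal.ofReal (κ ^ 2) • τ) (Metric.closedBall x r)
        ≤ ENNReal.ofReal (κ ^ 2) * τ (Metric.ball x s) := by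
          rw [Measure.smul_apply, smul_eq_mul]
          gcongr
          exact Metric.closedBall_subset_ball hs.1
      _ ≤ σ (Metric.ball x s) := by
          rw [hτE _ Metric.isOpen_ball.measurableSet hsΩ,
            hσE _ Metric.isOpen_ball.measurableSet hsΩ]
          exact hs2
      _ ≤ σ (Metric.closedBall x s) := measure_mono Metric.ball_subset_closedBall
  rw [← hτE E hE hEΩ', ← hσE E hE hEΩ']
  have hlim : Tendsto (fun κ : ℝ => ENNReal.ofReal (κ ^ 2) * τ E) (𝓝[<] 1) (𝓝 (1 * τ E)) := by
    refine ENNReal.Tendsto.mul_const ?_ (Or.inl one_ne_zero)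
    have h1 : Continuous fun κ : ℝ => ENNReal.ofReal (κ ^ 2) :=
      ENNReal.continuous_ofReal.comp (by fun_prop)
    have h2 := (h1.tendsto 1).mono_left (nhdsWithin_le_nhds (s := Iio 1))
    simpa using h2
  rw [one_mul] at hlim
  refine le_of_tendsto hlim ?_
  filter_upwards [Ioo_mem_nhdsLT (zero_lt_one' ℝ)] with κ h using hκ κ h

end

/-! ### The zero set -/

section

variable {Ω : Set (Euc n)} {φ : Euc n → ℝ} {μ : Measure (Euc n)} {q : ℝ}

/-- If `μ` vanishes on Lebesgue null subsets of `Ω`, an admissible function has no Monge–Ampère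
mass on its zero set: in the interior of that convex set the only subgradient is `0`, and its
frontier is a null set. -/
theorem mongeAmpere_eq_zero_of_eq_zero [Nontrivial (Euc n)] (hΩ : ConvexDomain Ω)
    (hac : μ.restrict Ω ≪ volume) {v : Euc n → ℝ} (hv : v ∈ admissible Ω μ φ q)
    {E : Set (Euc n)} (hE : MeasurableSet E) (hEΩ : E ⊆ Ω) (hE0 : ∀ x ∈ E, v x = 0) :
    mongeAmpere Ω v E = 0 := by
  set Z := {x | x ∈ closure Ω ∧ v x ≤ 0} with hZ
  have hZc : Convex ℝ Z := hv.2.1.convex_le 0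
  have hEZ : E ⊆ Z := fun x hx => ⟨subset_closure (hEΩ hx), (hE0 x hx).le⟩
  refine le_antisymm ((mongeAmpere_le_inter_add_diff E (interior Z)).trans ?_) zero_le
  have h1 : mongeAmpere Ω v (E ∩ interior Z) = 0 := by
    refine measure_mono_null (fun p hp => ?_) (measure_singleton (0 : Euc n))
    obtain ⟨x, hx, hpx⟩ := mem_iUnion₂.1 hp
    obtain ⟨δ, hδ, hball⟩ := Metric.isOpen_iff.1 (hΩ.isOpen.inter isOpen_interior) x
      ⟨hEΩ hx.1, hx.2⟩
    have h2 : ‖p‖ * (δ / 2) ≤ 0 := norm_mul_half_le_of_inner_le hδ subset_rfl fun y hy => by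
      have h3 := hpx y (hball hy).1
      rw [hE0 x hx.1] at h3
      linarith [(interior_subset (hball hy).2 : y ∈ Z).2]
    have h4 : ‖p‖ ≤ 0 := by nlinarith [norm_nonneg p]
    exact norm_le_zero_iff.1 h4
  have hm : MeasurableSet (E \ interior Z) := hE.diff isOpen_interior.measurableSet
  have hmΩ : E \ interior Z ⊆ Ω := sdiff_subset.trans hEΩ
  have h2 : mongeAmpere Ω v (E \ interior Z) = 0 := by
    refine le_antisymm ((hv.2.2.2.2 _ hm hmΩ).trans (le_of_eq ?_)) zero_le
    refine withDensity_absolutelyContinuous _ _ ?_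
    have hfr : E \ interior Z ⊆ frontier Z := fun x hx => ⟨subset_closure (hEZ hx.1), hx.2⟩
    have h3 : volume (E \ interior Z) = 0 := measure_mono_null hfr (hZc.addHaar_frontier volume)
    have h4 := hac h3
    rwa [Measure.restrict_apply hm, inter_eq_left.2 hmΩ] at h4
  rw [h1, h2, add_zero]

/-- The equation in `Ω` for a measure with a density, with the right side cut off outside the
positivity set. -/
theorem solvesDet_of_density [Nontrivial (Euc n)] (hΩ : ConvexDomain Ω)
    {v : Euc n → ℝ} (hv : v ∈ admissible Ω μ φ q)
    (hpos : ∀ E, MeasurableSet E → E ⊆ {x | 0 < v x} ∩ Ω →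
      mongeAmpere Ω v E = powMeasure v q μ E)
    {g : Euc n → ℝ} (hg : AEMeasurable g (volume.restrict Ω))
    (hμg : μ.restrict Ω = (volume.restrict Ω).withDensity fun x => ENNReal.ofReal (g x)) :
    SolvesDet Ω v fun x => g x * v x ^ q * indicator {y | 0 < v y} (fun _ => (1 : ℝ)) x := by
  intro E hE hEΩ
  set P := E ∩ v ⁻¹' Ioi 0 with hP
  have hPm : MeasurableSet P := measurableSet_inter_preimage hΩ hv.1 hE hEΩ measurableSet_Ioi
  have hPE : P ⊆ E := inter_subset_left
  have hPΩ : P ⊆ Ω := hPE.trans hEΩ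
  have hDm : MeasurableSet (E \ P) := hE.diff hPm
  have hD0 : ∀ x ∈ E \ P, v x = 0 := fun x hx =>
    le_antisymm (not_lt.1 fun h => hx.2 ⟨hx.1, h⟩) (hv.2.2.1 x (subset_closure (hEΩ hx.1)))
  have hac : μ.restrict Ω ≪ volume := by
    rw [hμg]
    exact (withDensity_absolutelyContinuous _ _).trans Measure.absolutelyContinuous_restrict
  have h1 : mongeAmpere Ω v E = powMeasure v q μ P := by
    rw [← hpos P hPm fun x hx => ⟨hx.2, hPΩ hx⟩, mongeAmpere_eq hΩ hv.1 hE hEΩ,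
      mongeAmpere_eq hΩ hv.1 hPm hPΩ, ← measure_inter_add_sdiff E hPm, inter_eq_right.2 hPE,
      ← mongeAmpere_eq hΩ hv.1 hDm (sdiff_subset.trans hEΩ),
      mongeAmpere_eq_zero_of_eq_zero hΩ hac hv hDm (sdiff_subset.trans hEΩ) hD0, add_zero]
  have h2 : μ.restrict P = (volume.restrict P).withDensity fun x => ENNReal.ofReal (g x) := by
    rw [← inter_eq_left.2 hPΩ, ← Measure.restrict_restrict hPm, hμg,
      restrict_withDensity hPm, Measure.restrict_restrict hPm]
  have hgP : AEMeasurable g (volume.restrict P) :=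
    hg.mono_measure (Measure.restrict_mono_set _ hPΩ)
  rw [h1, powMeasure_apply hPm, h2, lintegral_withDensity_eq_lintegral_mul₀ hgP.ennreal_ofReal
    ((aemeasurable_of_continuousOn_closure hΩ hv.1 hPΩ).pow_const q).ennreal_ofReal,
    ← lintegral_inter_add_sdiff _ E hPm, inter_eq_right.2 hPE]
  have h3 : ∫⁻ x in E \ P, ENNReal.ofReal
      (g x * v x ^ q * indicator {y | 0 < v y} (fun _ => (1 : ℝ)) x) = 0 := by
    refine setLIntegral_eq_zero hDm fun x hx => ?_
    have : x ∉ {y | 0 < v y} := fun h => (hD0 x hx ▸ h : (0 : ℝ) < 0).ne rfl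
    simp [indicator_of_notMem this]
  rw [h3, add_zero]
  refine setLIntegral_congr_fun hPm fun x hx => ?_
  have : x ∈ {y | 0 < v y} := hx.2
  simp only [indicator_of_mem this, mul_one, Pi.mul_apply]
  rw [ENNReal.ofReal_mul' (Real.rpow_nonneg (le_of_lt hx.2) q)]

end

end MongeAmpereObstacle

theorem mainTheorem11 (n : ℕ) (hn : 2 ≤ n) (Ω : Set (EuclideanSpace ℝ (Fin n)))
    (hΩo : IsOpen Ω) (hΩc : Convex ℝ Ω) (hΩb : Bornology.IsBounded Ω)
    (μ₀ : Measure (EuclideanSpace ℝ (Fin n))) (hμ₀ : μ₀ Ω < ∞)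
    (φ : EuclideanSpace ℝ (Fin n) → ℝ) (hφ : ContinuousOn φ (closure Ω))
    (hφc : ConvexOn ℝ (closure Ω) φ) (hφ0 : ∀ x ∈ frontier Ω, 0 ≤ φ x)
    (q : ℝ) (hq0 : 0 ≤ q) (hqn : q < n) :
    ∃ v : EuclideanSpace ℝ (Fin n) → ℝ,
      (∀ x ∈ closure Ω,
        IsGLB ((fun w => w x) '' MongeAmpereObstacle.admissible Ω μ₀ φ q) (v x)) ∧
      v ∈ MongeAmpereObstacle.admissible Ω μ₀ φ q ∧
      (∀ E, MeasurableSet E → E ⊆ {x | 0 < v x} ∩ Ω →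
        MongeAmpereObstacle.mongeAmpere Ω v E = MongeAmpereObstacle.powMeasure v q μ₀ E) ∧
      ∀ g : EuclideanSpace ℝ (Fin n) → ℝ, MemLp g ∞ (volume.restrict Ω) →
        (∀ᵐ x ∂(volume.restrict Ω), 0 ≤ g x) →
        μ₀.restrict Ω = (volume.restrict Ω).withDensity (fun x => ENNReal.ofReal (g x)) →
        MongeAmpereObstacle.SolvesDet Ω v
          (fun x => g x * v x ^ q * Set.indicator {y | 0 < v y} (fun _ => (1 : ℝ)) x) := by
  have hnt : Nontrivial (MongeAmpereObstacle.Euc n) :=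
    Module.nontrivial_of_finrank_pos (R := ℝ) (by rw [finrank_euclideanSpace_fin]; omega)
  rcases Ω.eq_empty_or_nonempty with rfl | hne
  · refine ⟨fun _ => 0, by simp, ⟨by simp, ?_, by simp, by simp, fun E _ hE => ?_⟩,
      fun E _ hE => ?_, fun g _ _ _ E _ hE => ?_⟩
    · rw [closure_empty]
      exact ⟨convex_empty, fun x hx => hx.elim⟩
    · simp [subset_empty_iff.1 hE, MongeAmpereObstacle.mongeAmpere]
    · rw [inter_empty] at hE
      simp [subset_empty_iff.1 hE, MongeAmpereObstacle.mongeAmpere]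
    · simp [subset_empty_iff.1 hE, MongeAmpereObstacle.mongeAmpere]
  · have hΩ : MongeAmpereObstacle.ConvexDomain Ω := ⟨hΩo, hΩc, hΩb, hne⟩
    obtain ⟨v, hv, hleast⟩ :=
      MongeAmpereObstacle.exists_least_admissible hΩ hφ hφc hφ0 hμ₀ hq0
    have hpos : ∀ E, MeasurableSet E → E ⊆ {x | 0 < v x} ∩ Ω →
        MongeAmpereObstacle.mongeAmpere Ω v E = MongeAmpereObstacle.powMeasure v q μ₀ E :=
      fun E hE hEΩ => MongeAmpereObstacle.mongeAmpere_eq_powMeasure_of_pos hΩ hφ hφc hμ₀ hq0 hv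
        hleast hE hEΩ
    refine ⟨v, fun x hx => ⟨?_, fun b hb => hb ⟨v, hv, rfl⟩⟩, hv, hpos, fun g hg _ hμg =>
      MongeAmpereObstacle.solvesDet_of_density hΩ hv hpos hg.aestronglyMeasurable.aemeasurable hμg⟩
    rintro _ ⟨w, hw, rfl⟩
    exact hleast w hw x hx
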